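/- **Setting.** Consider $N_q$ qubits with the Hamiltonian $H=H_0+\sum_{\beta=1}^{N_c}J_\beta V_\beta$, where $H_0=-\sum_n h_nZ_n$ with all $h_n>0$ and $V_\beta\in\{I,X,Y,Z\}^{\otimes N_q}$. For $\vec k\in\mathbb N^{N_c}$ put $\vec V^{\cdot\vec k}=V_{N_c}^{k_{N_c}}\cdots V_1^{k_1}$ (products run from right to left), and define $\vec s(\vec k)\in\{0,1\}^{N_q}$ by $\vec V^{\cdot\vec k}|\vec 0\rangle=i^{\Gamma(\vec k)}|\vec s(\vec k)\rangle$. Let $|\tilde E_0\rangle$ be the formal power series in $\vec J$ that solves the Dyson equation $$|\tilde E_0\rangle=|\vec 0\rangle+(E^{(0)}_0-H_0)^{-1}\Big(\sum_\beta J_\beta V_\beta-\Delta\Big)|\tilde E_0\rangle,\qquad \Delta=\langle\vec 0|\sum_\beta J_\beta V_\beta|\tilde E_0\rangle$$ (the perturbed ground state with $\langle\vec 0|\tilde E_0\rangle=1$), let $|E_0\rangle=\langle\tilde E_0|\tilde E_0\rangle^{-1/2}|\tilde E_0\rangle=\sum_{\vec k}\vec J^{\cdot\vec k}|\Psi_{\vec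 k}\rangle$ be the normalized ground state series, and let $C_{\vec k}=\langle\vec 0|\vec V^{\cdot\vec k\dagger}|\Psi_{\vec k}\rangle$, so that $|\Psi_{\vec k}\rangle=C_{\vec k}\vec V^{\cdot\vec k}|\vec 0\rangle$. **Ansatz.** Let $U(\vec\theta)=e^{i\theta_{N_p}T_{N_p}}\cdots e^{i\theta_1T_1}$ with $T_i\in\{I,X,Y,Z\}^{\otimes N_q}$ and $\theta_i=\sum_{\vec k}\theta_i^{(\vec k)}\vec J^{\cdot\vec k}$, $\theta_i^{(\vec k)}\in\mathbb R$. It is *generating*: for every $\vec s\neq\vec 0$ and $a\in\{0,1\}$ there is a chosen generator $T_{\vec s,a}$ among the $T_i$ with $T_{\vec s,a}|\vec 0\rangle=i^a|\vec s\rangle$. (A generator $T_{\vec 0,0}$ with $T_{\vec 0,0}|\vec 0\rangle=|\vec 0\rangle$, such as the identity, which only changes the global phase, may be included, but need not be.) For finitely supported $f:\mathbb N^{N_c}\to\mathbb N^{N_p}$ put $\vec N(f)=\sum_{\vec k}\vec f(\vec k)$, $\vec K(f)=\sum_{i,\vec k}f_i(\vec k)\,\vec k$ and $\Theta(f)=\prod_{\vec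 k,i}[\theta_i^{(\vec k)}]^{f_i(\vec k)}/f_i(\vec k)!$. **Support, disconnected, matched.** The support of $\vec k$ is the set of qubits on which some $V_\beta$ with $k_\beta\ne0$ acts nontrivially. $\vec k$ is *disconnected* if $\vec k=\vec k_A+\vec k_B$ with $\vec k_A,\vec k_B\neq\vec 0$ of disjoint supports. The pair $(\vec k,f)$ acts on the support of $\vec k$ together with all qubits that are flipped (by a factor $X$ or $Y$) by some generator $T_i$ with $N(f)_i\neq0$. The ansatz is *matched* to the perturbation if $$\langle \vec 0|\vec V^{\cdot\vec k\dagger}\vec T^{\cdot\vec N(f)}|\vec 0\rangle\,\langle \vec 0|\vec V^{\cdot\vec k'\dagger}\vec T^{\cdot\vec N(f')}|\vec 0\rangle=\langle \vec 0|\vec V^{\cdot(\vec k+\vec k')\dagger}\vec T^{\cdot\vec N(f+f')}|\vec 0\rangle$$ whenever $(\vec k,f)$ and $(\vec k',f')$ act on disjoint sets of qubits. **Theorem (digital linked-cluster theorem).** Let a generating Pauli ansatz be matched to the perturbation, and let real parameters $\theta_i^{(\vec k)}$ solve the order-by-order equations $$C_{\vec k}-\sum_{f:\ \vec K(f)=\vec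 k}i^{|\vec N(f)|}\,\Theta(f)\,\langle\vec 0|\vec V^{\cdot\vec k\dagger}\vec T^{\cdot\vec N(f)}|\vec 0\rangle=0\qquad\text{for all }\vec k\in\mathbb N^{N_c},$$ where $\theta_i^{(\vec 0)}=0$ for all $i$, and $\theta_i^{(\vec k)}=0$ unless $T_i$ is one of the chosen generators $T_{\vec s(\vec k),a}$. Then $\theta^{(\vec k)}_{\vec s(\vec k),a}=0$ for every disconnected $\vec k$ and every $a$ for which $T_{\vec s(\vec k),a}$ is present. Thus disconnected perturbative diagrams never contribute to the ansatz angles. -/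

import Mathlib

open scoped Matrix

noncomputable section

/-! ### Qubits and Pauli strings -/

/-- Labels of computational basis states of `n` qubits; addition is bitwise modulo 2. -/
abbrev Bits (n : ℕ) : Type := Fin n → Fin 2

/-- State vectors of `n` qubits, written in the computational basis. -/
abbrev QState (n : ℕ) : Type := Bits n → ℂ

/-- Linear operators on `n` qubits, written in the computational basis. -/
abbrev QOp (n : ℕ) : Type := Matrix (Bits n) (Bits n) ℂ

/-- The computational basis state `|s⟩`. -/
def ket {n : ℕ} (s : Bits n) : QState n := Pi.single s 1

/-- The four single-qubit Pauli labels. -/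
inductive Pauli : Type
  | I | X | Y | Z
  deriving DecidableEq

/-- The single-qubit Pauli matrices. -/
def Pauli.toMatrix : Pauli → Matrix (Fin 2) (Fin 2) ℂ
  | .I => !![1, 0; 0, 1]
  | .X => !![0, 1; 1, 0]
  | .Y => !![0, -Complex.I; Complex.I, 0]
  | .Z => !![1, 0; 0, -1]

/-- Whether a single-qubit Pauli operator flips the qubit (`1` for `X`, `Y` and `0` for `I`, `Z`). -/
def Pauli.flip : Pauli → Fin 2
  | .I => 0
  | .X => 1
  | .Y => 1
  | .Z => 0

/-- Elements of `{I, X, Y, Z}^{⊗ n}`, given by the tensor factors. -/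
abbrev PauliString (n : ℕ) : Type := Fin n → Pauli

/-- The operator `P_0 ⊗ P_1 ⊗ ⋯ ⊗ P_{n-1}`. -/
def PauliString.toOp {n : ℕ} (P : PauliString n) : QOp n :=
  Matrix.of fun x y => ∏ j, (P j).toMatrix (x j) (y j)

/-- The qubits flipped by a Pauli string. -/
def PauliString.flips {n : ℕ} (P : PauliString n) : Bits n := fun j => (P j).flip

/-- The ordered monomial `A_{m-1}^{k_{m-1}} ⋯ A_1^{k_1} A_0^{k_0}`: products run from right to
left, so that the factor with index `0` acts first. -/
def opMonomial {n m : ℕ} (A : Fin m → PauliString n) (k : Fin m →₀ ℕ) : QOp n :=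
  (List.ofFn fun i => (A i).toOp ^ k i).reverse.prod

/-- The basis label `s(k)`, determined by `V^k |0⟩ = i^Γ(k) |s(k)⟩`
(see `opMonomial_mulVec_ket_zero`). -/
def stateLabel {n m : ℕ} (V : Fin m → PauliString n) (k : Fin m →₀ ℕ) : Bits n :=
  ∑ i, k i • (V i).flips

/-! ### Perturbation series of the ground state

The Hamiltonian is `H = H₀ + ∑ β, J β • V β` with `H₀ = - ∑ j, h j • Z_j`.  Series in the couplings
`J` are families of coefficients indexed by multi-indices `k : Fin m →₀ ℕ`. -/

/-- The energy of `|s⟩` under `H₀`. -/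
def unperturbedEnergy {n : ℕ} (h : Fin n → ℝ) (s : Bits n) : ℝ :=
  -∑ j, (-1 : ℝ) ^ (s j : ℕ) * h j

/-- The reduced resolvent `(E₀ - H₀)⁻¹`, which is extended by `0` to the span of `|0⟩`. -/
def reducedResolvent {n : ℕ} (h : Fin n → ℝ) (ψ : QState n) : QState n := fun s =>
  if s = 0 then 0
  else ψ s / ((unperturbedEnergy h 0 - unperturbedEnergy h s : ℝ) : ℂ)

/-- The coefficient of `J^k` in `(∑ β, J β • V β) ψ(J)`. -/
def perturb {n m : ℕ} (V : Fin m → PauliString n) (ψ : (Fin m →₀ ℕ) → QState n)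
    (k : Fin m →₀ ℕ) : QState n :=
  ∑ β, if 0 < k β then (V β).toOp *ᵥ ψ (k - Finsupp.single β 1) else 0

/-- The right-hand side of the Dyson equation
`ψ = |0⟩ + (E₀ - H₀)⁻¹ (∑ β, J β • V β - Δ) ψ`, where `Δ = ⟨0| ∑ β, J β • V β |ψ⟩`,
as a map on power series. -/
def dysonMap {n m : ℕ} (h : Fin n → ℝ) (V : Fin m → PauliString n)
    (ψ : (Fin m →₀ ℕ) → QState n) (k : Fin m →₀ ℕ) : QState n :=
  (if k = 0 then ket 0 else 0) +
    reducedResolvent h (perturb V ψ k -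
      ∑ q ∈ Finset.HasAntidiagonal.antidiagonal k, perturb V ψ q.1 0 • ψ q.2)

/-- The coefficients of the perturbed ground state normalized by `⟨0|Ẽ₀⟩ = 1`: the solution of the
Dyson equation (see `dysonMap_unnormalizedGround`).  An iteration of the Dyson equation fixes at
least one more order, so the coefficient at `k` is reached after `|k| + 1` iterations. -/
def unnormalizedGround {n m : ℕ} (h : Fin n → ℝ) (V : Fin m → PauliString n)
    (k : Fin m →₀ ℕ) : QState n :=
  ((dysonMap h V)^[k.degree + 1] 0) k

/-- The power series `⟨Ẽ₀|Ẽ₀⟩` in the (real) couplings. -/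
def normSqSeries {n m : ℕ} (h : Fin n → ℝ) (V : Fin m → PauliString n) :
    MvPowerSeries (Fin m) ℂ := fun k =>
  ∑ q ∈ Finset.HasAntidiagonal.antidiagonal k,
    star (unnormalizedGround h V q.1) ⬝ᵥ unnormalizedGround h V q.2

/-- The power series `⟨Ẽ₀|Ẽ₀⟩^(-1/2)`: the binomial series of `(1 + x)^(-1/2)` at
`x = ⟨Ẽ₀|Ẽ₀⟩ - 1`, which has no constant term. -/
def normalizationSeries {n m : ℕ} (h : Fin n → ℝ) (V : Fin m → PauliString n) :
    MvPowerSeries (Fin m) ℂ :=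
  PowerSeries.subst (normSqSeries h V - 1) (PowerSeries.binomialSeries ℂ (-1 / 2 : ℚ))

/-- The coefficients `|Ψ_k⟩` of the normalized ground state `|E₀⟩ = ∑ k, J^k |Ψ_k⟩`. -/
def ground {n m : ℕ} (h : Fin n → ℝ) (V : Fin m → PauliString n) (k : Fin m →₀ ℕ) : QState n :=
  ∑ q ∈ Finset.HasAntidiagonal.antidiagonal k,
    MvPowerSeries.coeff q.1 (normalizationSeries h V) • unnormalizedGround h V q.2

/-- The number `C_k` with `|Ψ_k⟩ = C_k V^k |0⟩`, that is, `C_k = ⟨0|(V^k)† |Ψ_k⟩`. -/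
def groundCoeff {n m : ℕ} (h : Fin n → ℝ) (V : Fin m → PauliString n) (k : Fin m →₀ ℕ) : ℂ :=
  star (opMonomial V k *ᵥ ket 0) ⬝ᵥ ground h V k

/-! ### Taylor expansion of the ansatz

The ansatz is `U(θ)|0⟩` with `U(θ) = exp(i θ_{p-1} T_{p-1}) ⋯ exp(i θ_0 T_0)` and
`θ_i = ∑ k, θ i k * J^k`.  Its terms are indexed by finitely supported functions `f` from
multi-indices to powers of the generators. -/

/-- The index set of the expansion of the ansatz. -/
abbrev ExpIndex (m p : ℕ) : Type := (Fin m →₀ ℕ) →₀ (Fin p →₀ ℕ)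

/-- `N(f) = ∑ k, f(k)`. -/
def totalPower {m p : ℕ} (f : ExpIndex m p) : Fin p →₀ ℕ := f.sum fun _ a => a

/-- `K(f) = ∑ k, ∑ i, f_i(k) k`. -/
def totalOrder {m p : ℕ} (f : ExpIndex m p) : Fin m →₀ ℕ := f.sum fun k a => a.degree • k

/-- `Θ(f) = ∏ k, ∏ i, (θ_i^(k))^(f_i(k)) / f_i(k)!`. -/
def thetaWeight {m p : ℕ} (θ : Fin p → (Fin m →₀ ℕ) → ℝ) (f : ExpIndex m p) : ℝ :=
  f.prod fun k a => ∏ i, θ i k ^ a i / (Nat.factorial (a i) : ℝ)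

/-- `⟨0|(V^k)† T^(N(f))|0⟩`. -/
def amplitude {n m p : ℕ} (V : Fin m → PauliString n) (T : Fin p → PauliString n)
    (k : Fin m →₀ ℕ) (f : ExpIndex m p) : ℂ :=
  star (opMonomial V k *ᵥ ket 0) ⬝ᵥ (opMonomial T (totalPower f) *ᵥ ket 0)

/-- `⟨0|(V^k)†|φ_k⟩`, where `|φ_k⟩ = ∑_{f : K(f) = k} i^|N(f)| Θ(f) T^(N(f)) |0⟩` is the
coefficient of `J^k` in `U(θ)|0⟩`.  If `θ i 0 = 0` for all `i`, the sum has finitely many nonzero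
terms. -/
def ansatzCoeff {n m p : ℕ} (V : Fin m → PauliString n) (T : Fin p → PauliString n)
    (θ : Fin p → (Fin m →₀ ℕ) → ℝ) (k : Fin m →₀ ℕ) : ℂ :=
  ∑ᶠ (f : ExpIndex m p) (_ : totalOrder f = k),
    Complex.I ^ (totalPower f).degree * (thetaWeight θ f : ℂ) * amplitude V T k f

/-! ### Generating and matched ansatzes, the hierarchy of equations -/

/-- The Pauli ansatz with generators `T` is generating, and `gen` singles out the generators
`T_{s,a}` with `T_{s,a}|0⟩ = i^a |s⟩`: they exist for all `s ≠ 0`.  A generator with label `s = 0`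
(such as the identity, which changes the global phase) may be present but need not be. -/
structure IsGenerating {n p : ℕ} (T : Fin p → PauliString n)
    (gen : Bits n → Fin 2 → Option (Fin p)) : Prop where
  acts : ∀ s a i, gen s a = some i → (T i).toOp *ᵥ ket 0 = Complex.I ^ (a : ℕ) • ket s
  total : ∀ s, s ≠ 0 → ∀ a, ∃ i, gen s a = some i

/-- The support of `k`: the qubits on which some activated `V i` acts nontrivially. -/
def indexSupport {n m : ℕ} (V : Fin m → PauliString n) (k : Fin m →₀ ℕ) : Set (Fin n) :=
  {j | ∃ i, k i ≠ 0 ∧ V i j ≠ Pauli.I}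

/-- `k` is disconnected: it splits into two nonzero pieces with disjoint supports. -/
def IsDisconnected {n m : ℕ} (V : Fin m → PauliString n) (k : Fin m →₀ ℕ) : Prop :=
  ∃ kA kB : Fin m →₀ ℕ, kA ≠ 0 ∧ kB ≠ 0 ∧ k = kA + kB ∧
    Disjoint (indexSupport V kA) (indexSupport V kB)

/-- The part of the system on which `(k, f)` acts: the support of `k`, and the qubits `j` with
`s_j = 1` for the label `s` of some generator that occurs in `f`. -/
def actedRegion {n m p : ℕ} (V : Fin m → PauliString n) (T : Fin p → PauliString n)
    (k : Fin m →₀ ℕ) (f : ExpIndex m p) : Set (Fin n) :=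
  indexSupport V k ∪ {j | ∃ i, totalPower f i ≠ 0 ∧ (T i).flips j = 1}

/-- The ansatz with generators `T` is matched to the perturbation `V`. -/
def IsMatched {n m p : ℕ} (V : Fin m → PauliString n) (T : Fin p → PauliString n) : Prop :=
  ∀ (k k' : Fin m →₀ ℕ) (f f' : ExpIndex m p),
    Disjoint (actedRegion V T k f) (actedRegion V T k' f') →
      amplitude V T k f * amplitude V T k' f' = amplitude V T (k + k') (f + f')

/-- The parameters `θ` solve the fixing equations order by order, where at each order `k` only the
parameters of the generators `T_{s(k),a}` are used. -/
structure SolvesFixingEquations {n m p : ℕ} (h : Fin n → ℝ) (V : Fin m → PauliString n)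
    (T : Fin p → PauliString n) (gen : Bits n → Fin 2 → Option (Fin p))
    (θ : Fin p → (Fin m →₀ ℕ) → ℝ) : Prop where
  zero_order : ∀ i, θ i 0 = 0
  only_diagrams : ∀ i k, θ i k ≠ 0 → ∃ a, gen (stateLabel V k) a = some i
  fixing : ∀ k, groundCoeff h V k - ansatzCoeff V T θ k = 0

/-! ### Two checks of the definitions -/

theorem Pauli.toMatrix_apply (P : Pauli) (b : Fin 2) :
    ∃ g : ℕ, ∀ a, P.toMatrix a b = if a = b + P.flip then Complex.I ^ g else 0 := by
  cases P <;> fin_cases b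
  · exact ⟨0, fun a => by fin_cases a <;> simp [Pauli.toMatrix, Pauli.flip]⟩
  · exact ⟨0, fun a => by fin_cases a <;> simp [Pauli.toMatrix, Pauli.flip]⟩
  · exact ⟨0, fun a => by fin_cases a <;> simp [Pauli.toMatrix, Pauli.flip]⟩
  · exact ⟨0, fun a => by fin_cases a <;> simp [Pauli.toMatrix, Pauli.flip]⟩
  · exact ⟨1, fun a => by fin_cases a <;> simp [Pauli.toMatrix, Pauli.flip]⟩
  · exact ⟨3, fun a => by fin_cases a <;> simp [Pauli.toMatrix, Pauli.flip, Complex.I_pow_three]⟩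
  · exact ⟨0, fun a => by fin_cases a <;> simp [Pauli.toMatrix, Pauli.flip]⟩
  · exact ⟨2, fun a => by fin_cases a <;> simp [Pauli.toMatrix, Pauli.flip]⟩

theorem PauliString.toOp_mulVec_ket {n : ℕ} (P : PauliString n) (s : Bits n) :
    ∃ g : ℕ, P.toOp *ᵥ ket s = Complex.I ^ g • ket (s + P.flips) := by
  choose g hg using fun j => (P j).toMatrix_apply (s j)
  refine ⟨∑ j, g j, ?_⟩
  funext x
  simp only [PauliString.toOp, ket, Matrix.mulVec_single_one, Matrix.col_apply, Matrix.of_apply,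
    Pi.smul_apply, smul_eq_mul, hg]
  by_cases hx : x = s + P.flips
  · subst hx
    simp [PauliString.flips, Finset.prod_pow_eq_pow_sum]
  · obtain ⟨j, hj⟩ := Function.ne_iff.mp hx
    rw [Finset.prod_eq_zero (Finset.mem_univ j) (if_neg hj)]
    simp [hx]

theorem PauliString.toOp_pow_mulVec_ket {n : ℕ} (P : PauliString n) (r : ℕ) (s : Bits n) :
    ∃ g : ℕ, (P.toOp ^ r) *ᵥ ket s = Complex.I ^ g • ket (s + r • P.flips) := by
  induction r with
  | zero => exact ⟨0, by simp⟩
  | succ r ih =>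
    obtain ⟨g, hg⟩ := ih
    obtain ⟨g', hg'⟩ := P.toOp_mulVec_ket (s + r • P.flips)
    refine ⟨g + g', ?_⟩
    rw [pow_succ', ← Matrix.mulVec_mulVec, hg, Matrix.mulVec_smul, hg', smul_smul, ← pow_add,
      succ_nsmul, add_assoc]

/-- `V^k |0⟩ = i^Γ |s(k)⟩` for some `Γ`. -/
theorem opMonomial_mulVec_ket_zero {n m : ℕ} (V : Fin m → PauliString n) (k : Fin m →₀ ℕ) :
    ∃ g : ℕ, opMonomial V k *ᵥ ket 0 = Complex.I ^ g • ket (stateLabel V k) := by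
  have key : ∀ (l : List (Fin m)) (s : Bits n), ∃ g : ℕ,
      (l.map fun i => (V i).toOp ^ k i).reverse.prod *ᵥ ket s =
        Complex.I ^ g • ket (s + (l.map fun i => k i • (V i).flips).sum) := by
    intro l
    induction l with
    | nil => intro s; exact ⟨0, by simp⟩
    | cons i l ih =>
      intro s
      obtain ⟨g, hg⟩ := (V i).toOp_pow_mulVec_ket (k i) s
      obtain ⟨g', hg'⟩ := ih (s + k i • (V i).flips)
      refine ⟨g + g', ?_⟩
      simp only [List.map_cons, List.reverse_cons, List.prod_append, List.prod_cons, List.prod_nil,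
        mul_one, List.sum_cons]
      rw [← Matrix.mulVec_mulVec, hg, Matrix.mulVec_smul, hg', smul_smul, ← pow_add, add_assoc]
  obtain ⟨g, hg⟩ := key (List.finRange m) 0
  refine ⟨g, ?_⟩
  rw [zero_add, ← List.ofFn_eq_map, ← List.ofFn_eq_map, List.sum_ofFn] at hg
  exact hg

theorem dysonMap_congr {n m : ℕ} (h : Fin n → ℝ) (V : Fin m → PauliString n) (r : ℕ)
    (ψ φ : (Fin m →₀ ℕ) → QState n) (hr : ∀ k, k.degree < r → ψ k = φ k)
    (k : Fin m →₀ ℕ) (hk : k.degree < r + 1) : dysonMap h V ψ k = dysonMap h V φ k := by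
  have hp : ∀ k : Fin m →₀ ℕ, k.degree < r + 1 → perturb V ψ k = perturb V φ k := by
    intro k hk
    refine Finset.sum_congr rfl fun β _ => ?_
    split_ifs with hβ
    · have e : k - Finsupp.single β 1 + Finsupp.single β 1 = k :=
        tsub_add_cancel_of_le (Finsupp.single_le_iff.mpr hβ)
      have := congrArg Finsupp.degree e
      rw [map_add, Finsupp.degree_single] at this
      rw [hr _ (by omega)]
    · rfl
  have hz : ∀ χ : (Fin m →₀ ℕ) → QState n, perturb V χ 0 = 0 := fun χ => by simp [perturb]
  unfold dysonMap
  rw [hp k hk]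
  congr 3
  refine Finset.sum_congr rfl fun q hq => ?_
  have e := congrArg Finsupp.degree (Finset.HasAntidiagonal.mem_antidiagonal.mp hq)
  rw [map_add] at e
  rw [hp q.1 (by omega)]
  by_cases h0 : q.1 = 0
  · rw [h0, hz]; simp
  · have : q.1.degree ≠ 0 := fun hd => h0 ((Finsupp.degree_eq_zero_iff _).mp hd)
    rw [hr q.2 (by omega)]

/-- The unnormalized ground state solves the Dyson equation. -/
theorem dysonMap_unnormalizedGround {n m : ℕ} (h : Fin n → ℝ) (V : Fin m → PauliString n) :
    dysonMap h V (unnormalizedGround h V) = unnormalizedGround h V := by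
  have stab : ∀ (r : ℕ) (k : Fin m →₀ ℕ), k.degree < r →
      ((dysonMap h V)^[r] 0) k = ((dysonMap h V)^[r + 1] 0) k := by
    intro r
    induction r with
    | zero => intro k hk; omega
    | succ r ih =>
      intro k hk
      rw [Function.iterate_succ_apply', Function.iterate_succ_apply' _ (r + 1)]
      exact dysonMap_congr h V r _ _ ih k hk
  have stab' : ∀ (k : Fin m →₀ ℕ) (d : ℕ),
      ((dysonMap h V)^[k.degree + 1 + d] 0) k = unnormalizedGround h V k := by
    intro k d
    induction d with
    | zero => rfl
    | succ d ih => rw [← add_assoc, ← stab _ _ (by omega), ih]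
  funext k
  rw [← stab' k 1, Function.iterate_succ_apply']
  refine dysonMap_congr h V (k.degree + 1) _ _ (fun k' hk' => ?_) k (by omega)
  obtain ⟨d, hd⟩ := Nat.exists_eq_add_of_lt hk'
  rw [show k.degree + 1 = k'.degree + 1 + d by omega, stab']

end

noncomputable section

/-! The proof is a strong induction on the degree of `k`, comparing two factorizations at a
disconnected order `k = kA + kB`.

Perturbative side: if only the couplings occurring in `kA` and `kB` are kept, the Hamiltonian is a
sum of two terms acting on complementary regions of qubits. The product of the two separate
eigenvectors, each with `⟨0|·⟩ = 1`, is again such an eigenvector, and these are unique as formal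
power series (`SolvesEigen.unique`, `SolvesEigen.productState`). The squared norm factorizes as
well, hence so does its inverse square root, and `C_k = C_kA * C_kB` (`groundCoeff_add`).

Ansatz side: in a term of order `k` that does not involve the parameters of order `k` itself, every
parameter has lower order. By induction only connected orders survive, and a connected order below
`kA + kB` lies below `kA` or below `kB`. Such a term is therefore a unique product of a term of
order `kA` and one of order `kB`; matching makes the amplitudes multiply
(`SolvesFixingEquations.sum_nonlinear_eq_mul`). By the equations at `kA` and `kB` these terms sum to
`C_kA * C_kB = C_k`.

So the part linear in the parameters of order `k` must vanish. Its two generators carry the relative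
phase `i` and the parameters are real, so each parameter is zero
(`SolvesFixingEquations.eq_zero_of_linear`).

If some `V β` is the identity, `kA` and `kB` may share `β` in spite of disjoint supports. This case
is treated separately: an identity term only shifts the energy, so `C_k = 0` as soon as `k β ≠ 0`,
and the parameters vanish by an induction of their own (`SolvesFixingEquations.eq_zero_of_trivial`).
-/

/-! ### Product states and local Pauli strings -/

/-- The label that agrees with `s` on `A` and vanishes elsewhere. -/
def Bits.proj {n : ℕ} (A : Finset (Fin n)) (s : Bits n) : Bits n := fun j => if j ∈ A then s j else 0

/-- `P` acts trivially outside `A`. -/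
def PauliString.ActsWithin {n : ℕ} (P : PauliString n) (A : Finset (Fin n)) : Prop :=
  ∀ j, j ∉ A → P j = Pauli.I

/-- The action of a Pauli string on vectors with entries in a `ℂ`-module. -/
def PauliString.act {n : ℕ} {R : Type*} [AddCommMonoid R] [Module ℂ R] (P : PauliString n)
    (G : Bits n → R) : Bits n → R := fun s => ∑ t, P.toOp s t • G t

/-- The vector with entries `a (s|_A) * b (s|_{Aᶜ})`. -/
def productState {n : ℕ} {R : Type*} [Mul R] (A : Finset (Fin n)) (a b : Bits n → R) :
    Bits n → R := fun s => a (s.proj A) * b (s.proj Aᶜ)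

section local_action

variable {n : ℕ} {R : Type*}

theorem Bits.proj_zero (A : Finset (Fin n)) : Bits.proj A 0 = 0 := by
  funext j; simp [Bits.proj]

theorem Bits.proj_add (A : Finset (Fin n)) (s t : Bits n) :
    (s + t).proj A = s.proj A + t.proj A := by
  funext j
  by_cases hj : j ∈ A <;> simp [Bits.proj, hj]

theorem Bits.proj_add_proj_compl (A : Finset (Fin n)) (s : Bits n) :
    s.proj A + s.proj Aᶜ = s := by
  funext j
  by_cases hj : j ∈ A <;> simp [Bits.proj, hj]

theorem Bits.proj_compl_proj (A : Finset (Fin n)) (s : Bits n) : (s.proj A).proj Aᶜ = 0 := by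
  funext j
  by_cases hj : j ∈ A <;> simp [Bits.proj, hj]

theorem Bits.proj_eq_self_iff (A : Finset (Fin n)) (s : Bits n) :
    s.proj A = s ↔ s.proj Aᶜ = 0 := by
  constructor
  · intro h; rw [← h, Bits.proj_compl_proj]
  · intro h
    conv_rhs => rw [← Bits.proj_add_proj_compl A s]
    rw [h, add_zero]

theorem PauliString.ActsWithin.proj_flips {P : PauliString n} {A : Finset (Fin n)}
    (hP : P.ActsWithin A) : P.flips.proj A = P.flips := by
  funext j
  by_cases hj : j ∈ A
  · simp [Bits.proj, hj]
  · simp [Bits.proj, hj, PauliString.flips, hP j hj, Pauli.flip]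

theorem PauliString.toOp_apply_eq_zero (P : PauliString n) {s t : Bits n} (h : t ≠ s + P.flips) :
    P.toOp s t = 0 := by
  obtain ⟨j, hj⟩ := Function.ne_iff.mp h
  obtain ⟨g, hg⟩ := (P j).toMatrix_apply (t j)
  have hz : (P j).toMatrix (s j) (t j) = 0 := by
    rw [hg, if_neg]
    intro e
    apply hj
    have : ∀ x y : Fin 2, x = x + y + y := by decide
    rw [Pi.add_apply, e]
    exact this _ _
  rw [PauliString.toOp, Matrix.of_apply]
  exact Finset.prod_eq_zero (Finset.mem_univ j) hz

theorem PauliString.act_apply [AddCommMonoid R] [Module ℂ R] (P : PauliString n)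
    (G : Bits n → R) (s : Bits n) : P.act G s = P.toOp s (s + P.flips) • G (s + P.flips) := by
  refine Finset.sum_eq_single _ (fun t _ ht => ?_) (by simp)
  rw [P.toOp_apply_eq_zero ht, zero_smul]

/-- Outside `A` the tensor factors are `I` and contribute `1`, so the phase depends only on the bits
in `A`. -/
theorem PauliString.ActsWithin.toOp_proj {P : PauliString n} {A : Finset (Fin n)}
    (hP : P.ActsWithin A) (s : Bits n) :
    P.toOp (s.proj A) (s.proj A + P.flips) = P.toOp s (s + P.flips) := by
  rw [PauliString.toOp, Matrix.of_apply, Matrix.of_apply]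
  refine Finset.prod_congr rfl fun j _ => ?_
  by_cases hj : j ∈ A
  · simp [Bits.proj, hj]
  · have : ∀ x : Fin 2, Pauli.I.toMatrix x (x + Pauli.I.flip) = 1 := by
      intro x; fin_cases x <;> simp [Pauli.toMatrix, Pauli.flip]
    simp only [Pi.add_apply, PauliString.flips, hP j hj, this]

theorem PauliString.ActsWithin.act_productState [CommRing R] [Algebra ℂ R] {P : PauliString n}
    {A : Finset (Fin n)} (hP : P.ActsWithin A) (a b : Bits n → R) :
    P.act (productState A a b) = productState A (P.act a) b := by
  funext s
  have h1 : P.flips.proj Aᶜ = 0 := (Bits.proj_eq_self_iff A _).mp hP.proj_flips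
  rw [act_apply, productState, productState, act_apply, Bits.proj_add, Bits.proj_add,
    hP.proj_flips, h1, add_zero, hP.toOp_proj, smul_mul_assoc]

theorem productState_compl [CommRing R] (A : Finset (Fin n)) (a b : Bits n → R) :
    productState Aᶜ a b = productState A b a := by
  funext s
  rw [productState, productState, compl_compl, mul_comm]

theorem PauliString.ActsWithin.act_productState_compl [CommRing R] [Algebra ℂ R]
    {P : PauliString n} {A : Finset (Fin n)} (hP : P.ActsWithin Aᶜ) (a b : Bits n → R) :
    P.act (productState A a b) = productState A a (P.act b) := by
  rw [← productState_compl, hP.act_productState, productState_compl]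

/-- The inner sum over a product vector whose factors are supported on complementary regions. -/
theorem sum_productState [CommRing R] (A : Finset (Fin n)) (a b : Bits n → R)
    (ha : ∀ s, s.proj A ≠ s → a s = 0) (hb : ∀ s, s.proj Aᶜ ≠ s → b s = 0) :
    ∑ s, productState A a b s = (∑ s, a s) * ∑ s, b s := by
  rw [Finset.sum_mul_sum, ← Finset.sum_product']
  -- Pairs outside the image of this injection have a component with bits in the wrong region, where
  -- `a` or `b` vanishes.
  refine Finset.sum_of_injOn (fun s => (s.proj A, s.proj Aᶜ)) ?_ ?_ ?_ ?_
  · intro s _ t _ e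
    simp only [Prod.mk.injEq] at e
    rw [← Bits.proj_add_proj_compl A s, e.1, e.2, Bits.proj_add_proj_compl]
  · intro s _; simp
  · rintro ⟨s, t⟩ _ hst
    by_cases hs : s.proj A = s
    · by_cases ht : t.proj Aᶜ = t
      · refine absurd ⟨s + t, by simp, ?_⟩ hst
        have h1 : s.proj Aᶜ = 0 := (Bits.proj_eq_self_iff A s).mp hs
        have h2 : t.proj A = 0 := by
          have := (Bits.proj_eq_self_iff Aᶜ t).mp ht
          rwa [compl_compl] at this
        simp [Bits.proj_add, hs, ht, h1, h2]
      · simp [hb t ht]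
    · simp [ha s hs]
  · intro s _; rfl

end local_action

/-! ### Restriction of power series to a subset of the variables -/

section restrict

variable {m : ℕ}

/-- Set the variables outside `S` to zero. -/
def MvPowerSeries.restrict (S : Finset (Fin m)) :
    MvPowerSeries (Fin m) ℂ →+* MvPowerSeries (Fin m) ℂ where
  toFun F := fun k => if k.support ⊆ S then coeff k F else 0
  map_zero' := by
    ext k
    change (if k.support ⊆ S then coeff k (0 : MvPowerSeries (Fin m) ℂ) else 0) = 0
    simp
  map_one' := by
    ext k
    change (if k.support ⊆ S then coeff k (1 : MvPowerSeries (Fin m) ℂ) else 0) = _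
    rw [coeff_one]
    by_cases hk : k = 0 <;> simp [hk]
  map_add' F G := by
    ext k
    change (if k.support ⊆ S then coeff k (F + G) else 0) =
      (if k.support ⊆ S then coeff k F else 0) + (if k.support ⊆ S then coeff k G else 0)
    split_ifs <;> simp
  map_mul' F G := by
    ext k
    refine Eq.trans ?_ (coeff_mul k _ _).symm
    change (if k.support ⊆ S then coeff k (F * G) else 0) =
      ∑ q ∈ Finset.HasAntidiagonal.antidiagonal k, (if q.1.support ⊆ S then coeff q.1 F else 0) *
        (if q.2.support ⊆ S then coeff q.2 G else 0)
    -- Exponents cannot cancel, so the support of a sum is the union of the supports; this makes the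
    -- restriction multiplicative.
    have key : ∀ q ∈ Finset.HasAntidiagonal.antidiagonal k,
        (k.support ⊆ S ↔ q.1.support ⊆ S ∧ q.2.support ⊆ S) := by
      intro q hq
      rw [← Finset.HasAntidiagonal.mem_antidiagonal.mp hq]
      have : (q.1 + q.2).support = q.1.support ∪ q.2.support := by
        ext i; simp; tauto
      rw [this, Finset.union_subset_iff]
    rw [coeff_mul]
    split_ifs with hk
    · refine Finset.sum_congr rfl fun q hq => ?_
      have := (key q hq).mp hk
      rw [if_pos this.1, if_pos this.2]
    · refine (Finset.sum_eq_zero fun q hq => ?_).symm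
      have := mt (key q hq).mpr hk
      by_cases h1 : q.1.support ⊆ S
      · rw [if_neg (fun h2 => this ⟨h1, h2⟩), mul_zero]
      · rw [if_neg h1, zero_mul]

namespace MvPowerSeries

theorem coeff_restrict (S : Finset (Fin m)) (F : MvPowerSeries (Fin m) ℂ) (k : Fin m →₀ ℕ) :
    coeff k (restrict S F) = if k.support ⊆ S then coeff k F else 0 := rfl

theorem constantCoeff_restrict (S : Finset (Fin m)) (F : MvPowerSeries (Fin m) ℂ) :
    constantCoeff (restrict S F) = constantCoeff F := by
  rw [← coeff_zero_eq_constantCoeff_apply, coeff_restrict]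
  simp

theorem restrict_smul (S : Finset (Fin m)) (c : ℂ) (F : MvPowerSeries (Fin m) ℂ) :
    restrict S (c • F) = c • restrict S F := by
  ext k
  simp [coeff_restrict]

theorem restrict_X (S : Finset (Fin m)) (β : Fin m) :
    restrict S (X β) = if β ∈ S then X β else 0 := by
  ext k
  rw [coeff_restrict, coeff_X]
  by_cases hk : k = Finsupp.single β 1
  · subst hk
    rw [Finsupp.support_single _ one_ne_zero]
    by_cases hβ : β ∈ S <;> simp [hβ, coeff_X]
  · by_cases hβ : β ∈ S <;> simp [hβ, coeff_X, hk]

theorem restrict_map_star (S : Finset (Fin m)) (F : MvPowerSeries (Fin m) ℂ) :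
    restrict S (map (starRingEnd ℂ) F) = map (starRingEnd ℂ) (restrict S F) := by
  ext k
  rw [coeff_map, coeff_restrict, coeff_restrict, coeff_map]
  split_ifs <;> simp

/-- Coefficients of a product of series in disjoint sets of variables. -/
theorem coeff_add_of_restrict_union_eq_mul {SA SB : Finset (Fin m)} (hS : Disjoint SA SB)
    {F G H : MvPowerSeries (Fin m) ℂ} (e : restrict (SA ∪ SB) F = restrict SA G * restrict SB H)
    {kA kB : Fin m →₀ ℕ} (hA : kA.support ⊆ SA) (hB : kB.support ⊆ SB) :
    coeff (kA + kB) F = coeff kA G * coeff kB H := by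
  have hsub : (kA + kB).support ⊆ SA ∪ SB :=
    Finsupp.support_add.trans (Finset.union_subset_union hA hB)
  have := congrArg (coeff (kA + kB)) e
  rw [coeff_restrict, if_pos hsub, coeff_mul] at this
  rw [this, Finset.sum_eq_single (kA, kB)]
  · rw [coeff_restrict, coeff_restrict, if_pos hA, if_pos hB]
  · rintro ⟨q, r⟩ hq hne
    rw [coeff_restrict, coeff_restrict]
    by_cases h1 : q.support ⊆ SA
    · by_cases h2 : r.support ⊆ SB
      · exfalso
        apply hne
        have hqr : q + r = kA + kB := Finset.HasAntidiagonal.mem_antidiagonal.mp hq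
        have z : ∀ {x : Fin m →₀ ℕ} {S : Finset (Fin m)}, x.support ⊆ S → ∀ i, i ∉ S → x i = 0 :=
          fun hx i hi => Finsupp.notMem_support_iff.mp fun h => hi (hx h)
        have key : ∀ i, q i = kA i ∧ r i = kB i := by
          intro i
          have ei := DFunLike.congr_fun hqr i
          simp only [Finsupp.add_apply] at ei
          by_cases hi : i ∈ SA
          · have hi' := Finset.disjoint_left.mp hS hi
            have := z h2 i hi'
            have := z hB i hi'
            omega
          · have := z h1 i hi
            have := z hA i hi
            omega
        exact Prod.ext (Finsupp.ext fun i => (key i).1) (Finsupp.ext fun i => (key i).2)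
      · rw [if_neg h2, mul_zero]
    · rw [if_neg h1, zero_mul]
  · intro h
    refine absurd ?_ h
    rw [Finset.HasAntidiagonal.mem_antidiagonal]

/-- Inverse square roots with constant coefficient `1` are unique. -/
theorem eq_of_sq_mul_eq_one {F G N : MvPowerSeries (Fin m) ℂ} (hF : F ^ 2 * N = 1)
    (hG : G ^ 2 * N = 1) (cF : constantCoeff F = 1) (cG : constantCoeff G = 1) : F = G := by
  have hN : N ≠ 0 := by rintro rfl; simp at hF
  -- Power series over `ℂ` form a domain, so only a sign is left open; the constant coefficients fix
  -- it.
  have hsq : F ^ 2 = G ^ 2 := mul_right_cancel₀ hN (hF.trans hG.symm)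
  rcases sq_eq_sq_iff_eq_or_eq_neg.mp hsq with h | h
  · exact h
  · rw [h, map_neg, cG] at cF
    norm_num at cF

end MvPowerSeries

end restrict

/-! ### The ground state as a vector of power series -/

section ground_series

open MvPowerSeries

variable {n m : ℕ}

/-- The energy denominator `E₀ - E_s`. -/
def energyGap (h : Fin n → ℝ) (s : Bits n) : ℂ :=
  ((unperturbedEnergy h 0 - unperturbedEnergy h s : ℝ) : ℂ)

/-- The series `∑_{β ∈ S} J_β V_β G`. -/
def perturbSeries (V : Fin m → PauliString n) (S : Finset (Fin m))
    (G : Bits n → MvPowerSeries (Fin m) ℂ) (s : Bits n) : MvPowerSeries (Fin m) ℂ :=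
  ∑ β ∈ S, X β * (V β).act G s

/-- `G` is an eigenvector of `H₀ + ∑_{β ∈ S} J_β V_β` normalized by `⟨0|G⟩ = 1`. -/
structure SolvesEigen (h : Fin n → ℝ) (V : Fin m → PauliString n) (S : Finset (Fin m))
    (G : Bits n → MvPowerSeries (Fin m) ℂ) : Prop where
  normalized : G 0 = 1
  eigen : ∀ s, energyGap h s • G s = perturbSeries V S G s - perturbSeries V S G 0 * G s

/-- The series with coefficients `⟨s|ψ_k⟩` for the unnormalized ground state. -/
def groundSeries (h : Fin n → ℝ) (V : Fin m → PauliString n) (s : Bits n) :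
    MvPowerSeries (Fin m) ℂ := fun k => unnormalizedGround h V k s

/-- As a sum over the flipped qubits, the gap is visibly nonzero for `s ≠ 0` and additive over
complementary regions. -/
theorem energyGap_eq (h : Fin n → ℝ) (s : Bits n) :
    energyGap h s = ((∑ j, if s j = 0 then 0 else -(2 * h j) : ℝ) : ℂ) := by
  rw [energyGap, unperturbedEnergy, unperturbedEnergy, neg_sub_neg, ← Finset.sum_sub_distrib]
  congr 1
  refine Finset.sum_congr rfl fun j _ => ?_
  have : ∀ x : Fin 2, x = 0 ∨ x = 1 := by decide
  rcases this (s j) with e | e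
  · simp [e]
  · simp [e]; ring

theorem energyGap_zero (h : Fin n → ℝ) : energyGap h 0 = 0 := by
  simp [energyGap]

theorem energyGap_ne_zero {h : Fin n → ℝ} (h_pos : ∀ j, 0 < h j) {s : Bits n} (hs : s ≠ 0) :
    energyGap h s ≠ 0 := by
  rw [energyGap_eq]
  obtain ⟨j, hj⟩ := Function.ne_iff.mp hs
  refine Complex.ofReal_ne_zero.mpr (ne_of_lt (Finset.sum_neg' (fun i _ => ?_)
    ⟨j, Finset.mem_univ j, ?_⟩))
  · split_ifs
    · exact le_rfl
    · linarith [h_pos i]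
  · have hj' : ¬ s j = 0 := hj
    rw [if_neg hj']
    linarith [h_pos j]

theorem energyGap_proj_add (h : Fin n → ℝ) (A : Finset (Fin n)) (s : Bits n) :
    energyGap h (s.proj A) + energyGap h (s.proj Aᶜ) = energyGap h s := by
  rw [energyGap_eq, energyGap_eq, energyGap_eq, ← Complex.ofReal_add, ← Finset.sum_add_distrib]
  congr 1
  refine Finset.sum_congr rfl fun j _ => ?_
  by_cases hj : j ∈ A <;> simp [Bits.proj, hj]

theorem coeff_perturbSeries_groundSeries (h : Fin n → ℝ) (V : Fin m → PauliString n)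
    (s : Bits n) (k : Fin m →₀ ℕ) :
    coeff k (perturbSeries V Finset.univ (groundSeries h V) s) =
      perturb V (unnormalizedGround h V) k s := by
  rw [perturbSeries, map_sum, perturb, Finset.sum_apply]
  refine Finset.sum_congr rfl fun β _ => ?_
  rw [X, coeff_monomial_mul, one_mul]
  have hle : Finsupp.single β 1 ≤ k ↔ 0 < k β := by
    rw [Finsupp.single_le_iff, Nat.one_le_iff_ne_zero, Nat.pos_iff_ne_zero]
  by_cases hk : 0 < k β
  · rw [if_pos (hle.mpr hk), if_pos hk, PauliString.act, map_sum]
    rfl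
  · rw [if_neg (mt hle.mp hk), if_neg hk]
    rfl

/-- For `s ≠ 0` this is the Dyson equation multiplied by its nonzero denominator. At `s = 0` both
sides vanish, because the eigenvalue shift is itself the `0` component of the perturbed vector. -/
theorem groundSeries_solves {h : Fin n → ℝ} (h_pos : ∀ j, 0 < h j) (V : Fin m → PauliString n) :
    SolvesEigen h V Finset.univ (groundSeries h V) := by
  have hd : ∀ k s, unnormalizedGround h V k s = dysonMap h V (unnormalizedGround h V) k s :=
    fun k s => by rw [dysonMap_unnormalizedGround]
  have hn : groundSeries h V 0 = 1 := by
    ext k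
    change unnormalizedGround h V k 0 = _
    rw [hd, coeff_one]
    by_cases hk : k = 0 <;> simp [dysonMap, reducedResolvent, hk, ket]
  refine ⟨hn, fun s => ?_⟩
  by_cases hs : s = 0
  · subst hs
    rw [energyGap_zero, zero_smul, hn, mul_one, sub_self]
  · ext k
    have hg := energyGap_ne_zero h_pos hs
    rw [coeff_smul, map_sub, coeff_perturbSeries_groundSeries, coeff_mul]
    change energyGap h s * unnormalizedGround h V k s = _
    rw [hd]
    have hk : (if k = 0 then ket 0 else 0 : QState n) s = 0 := by
      split_ifs <;> simp [ket, hs]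
    rw [dysonMap, Pi.add_apply, hk, zero_add, reducedResolvent, if_neg hs]
    change energyGap h s * (_ / energyGap h s) = _
    rw [mul_div_cancel₀ _ hg, Pi.sub_apply, Finset.sum_apply]
    congr 1
    refine Finset.sum_congr rfl fun q _ => ?_
    rw [coeff_perturbSeries_groundSeries]
    rfl

theorem restrict_perturbSeries (V : Fin m → PauliString n) (S S' : Finset (Fin m))
    (G : Bits n → MvPowerSeries (Fin m) ℂ) (s : Bits n) :
    restrict S (perturbSeries V S' G s) =
      perturbSeries V (S' ∩ S) (fun t => restrict S (G t)) s := by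
  rw [perturbSeries, perturbSeries, map_sum, ← Finset.filter_mem_eq_inter, Finset.sum_filter]
  refine Finset.sum_congr rfl fun β _ => ?_
  rw [map_mul, restrict_X]
  split_ifs
  · simp only [PauliString.act, map_sum, restrict_smul]
  · rw [zero_mul]

/-- Switching off couplings is a ring homomorphism, so it maps the eigenvalue equation to that of
the smaller perturbation. -/
theorem SolvesEigen.restrict {h : Fin n → ℝ} {V : Fin m → PauliString n}
    {G : Bits n → MvPowerSeries (Fin m) ℂ} (hG : SolvesEigen h V Finset.univ G)
    (S : Finset (Fin m)) : SolvesEigen h V S (fun s => restrict S (G s)) := by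
  refine ⟨by rw [hG.normalized, map_one], fun s => ?_⟩
  have := congrArg (MvPowerSeries.restrict S) (hG.eigen s)
  rwa [restrict_smul, map_sub, map_mul, restrict_perturbSeries, restrict_perturbSeries,
    Finset.univ_inter] at this

/-! ### Uniqueness and multiplicativity of normalized eigenvectors. -/

theorem le_order_perturbSeries (V : Fin m → PauliString n) (S : Finset (Fin m))
    {G : Bits n → MvPowerSeries (Fin m) ℂ} {r : ℕ} (hG : ∀ s, (r : ℕ∞) ≤ (G s).order)
    (s : Bits n) : ((r + 1 : ℕ) : ℕ∞) ≤ (perturbSeries V S G s).order := by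
  refine nat_le_order fun k hk => ?_
  rw [perturbSeries, map_sum]
  refine Finset.sum_eq_zero fun β _ => ?_
  rw [X, coeff_monomial_mul]
  split_ifs with hβ
  · have e := congrArg Finsupp.degree (tsub_add_cancel_of_le hβ)
    rw [map_add, Finsupp.degree_single] at e
    rw [one_mul, PauliString.act, map_sum]
    refine Finset.sum_eq_zero fun t _ => ?_
    rw [coeff_smul, coeff_of_lt_order (lt_of_lt_of_le _ (hG t)), mul_zero]
    exact_mod_cast (by omega : (k - Finsupp.single β 1).degree < r)
  · rfl

theorem perturbSeries_sub (V : Fin m → PauliString n) (S : Finset (Fin m))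
    (G G' : Bits n → MvPowerSeries (Fin m) ℂ) (s : Bits n) :
    perturbSeries V S (fun t => G t - G' t) s =
      perturbSeries V S G s - perturbSeries V S G' s := by
  simp only [perturbSeries, PauliString.act, smul_sub, Finset.sum_sub_distrib, mul_sub]

/-- A contraction argument in the order of power series: if the difference of two solutions has
order at least `r`, the equation improves this to `r + 1`. -/
theorem SolvesEigen.unique {h : Fin n → ℝ} (h_pos : ∀ j, 0 < h j) {V : Fin m → PauliString n}
    {S : Finset (Fin m)} {G G' : Bits n → MvPowerSeries (Fin m) ℂ} (hG : SolvesEigen h V S G)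
    (hG' : SolvesEigen h V S G') : G = G' := by
  have key : ∀ r : ℕ, ∀ s, (r : ℕ∞) ≤ (G s - G' s).order := by
    intro r
    induction r with
    | zero => intro s; simp
    | succ r ih =>
      intro s
      by_cases hs : s = 0
      · subst hs
        rw [hG.normalized, hG'.normalized, sub_self, order_zero]
        exact le_top
      · have hg := energyGap_ne_zero h_pos hs
        have hW := le_order_perturbSeries V S ih
        -- Each summand contains either the perturbation applied to the difference, or the
        -- difference times the eigenvalue shift of `G'`, which has no constant term. Either way one
        -- order is gained.
        have e : G s - G' s = (energyGap h s)⁻¹ •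
            (perturbSeries V S (fun t => G t - G' t) s +
              ((-perturbSeries V S (fun t => G t - G' t) 0) * G s +
              (-perturbSeries V S G' 0) * (G s - G' s))) := by
          rw [eq_inv_smul_iff₀ hg, smul_sub, hG.eigen, hG'.eigen, perturbSeries_sub,
            perturbSeries_sub]
          ring
        have h0 : ((1 : ℕ) : ℕ∞) ≤ (perturbSeries V S G' 0).order :=
          le_order_perturbSeries V S (r := 0) (fun _ => by simp) 0
        rw [e]
        refine le_trans ?_ le_order_smul
        refine le_trans (le_min (hW s) ?_) min_order_le_add
        refine le_trans (le_min ?_ ?_) min_order_le_add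
        · refine le_trans ?_ le_order_mul
          rw [order_neg]
          exact (hW 0).trans le_self_add
        · refine le_trans ?_ le_order_mul
          rw [order_neg, Nat.cast_add, add_comm]
          exact add_le_add h0 (ih s)
  funext s
  rw [← sub_eq_zero, ← order_eq_top_iff]
  exact ENat.eq_top_iff_forall_ge.mpr fun r => key r s

/-- Eigenvectors of two perturbations that act on complementary regions multiply. -/
theorem SolvesEigen.productState {h : Fin n → ℝ} {V : Fin m → PauliString n}
    {SA SB : Finset (Fin m)} {A : Finset (Fin n)} {G G' : Bits n → MvPowerSeries (Fin m) ℂ}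
    (hS : Disjoint SA SB) (hA : ∀ β ∈ SA, (V β).ActsWithin A)
    (hB : ∀ β ∈ SB, (V β).ActsWithin Aᶜ) (hG : SolvesEigen h V SA G)
    (hG' : SolvesEigen h V SB G') : SolvesEigen h V (SA ∪ SB) (productState A G G') := by
  -- A Leibniz rule: every `V β` acts on only one of the two factors. Together with the additivity
  -- of the gap it yields the eigenvalue equation of the product.
  have hp : ∀ s, perturbSeries V (SA ∪ SB) (_root_.productState A G G') s =
      perturbSeries V SA G (s.proj A) * G' (s.proj Aᶜ) +
        G (s.proj A) * perturbSeries V SB G' (s.proj Aᶜ) := by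
    intro s
    rw [perturbSeries, Finset.sum_union hS, perturbSeries, perturbSeries, Finset.sum_mul,
      Finset.mul_sum]
    congr 1
    · refine Finset.sum_congr rfl fun β hβ => ?_
      rw [(hA β hβ).act_productState, _root_.productState, mul_assoc]
    · refine Finset.sum_congr rfl fun β hβ => ?_
      rw [(hB β hβ).act_productState_compl, _root_.productState, mul_left_comm]
  refine ⟨?_, fun s => ?_⟩
  · rw [_root_.productState, Bits.proj_zero, Bits.proj_zero, hG.normalized, hG'.normalized,
      mul_one]
  · rw [hp, hp, Bits.proj_zero, Bits.proj_zero, hG.normalized, hG'.normalized,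
      ← energyGap_proj_add h A s, add_smul, _root_.productState, ← smul_mul_assoc, hG.eigen,
      ← mul_smul_comm, hG'.eigen]
    ring

/-- The product of `G` with `|0⟩`, the eigenvector for the empty perturbation, solves the same
equation. By uniqueness it equals `G`, so no qubit outside `A` is excited. -/
theorem SolvesEigen.eq_zero_of_proj_ne {h : Fin n → ℝ} (h_pos : ∀ j, 0 < h j)
    {V : Fin m → PauliString n} {S : Finset (Fin m)} {A : Finset (Fin n)}
    {G : Bits n → MvPowerSeries (Fin m) ℂ} (hA : ∀ β ∈ S, (V β).ActsWithin A)
    (hG : SolvesEigen h V S G) {s : Bits n} (hs : s.proj A ≠ s) : G s = 0 := by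
  have hδ : SolvesEigen h V ∅ (Pi.single 0 1 : Bits n → MvPowerSeries (Fin m) ℂ) := by
    refine ⟨by simp, fun s => ?_⟩
    by_cases hs : s = 0
    · simp [hs, energyGap_zero, perturbSeries]
    · simp [hs, perturbSeries]
  have hprod := hG.productState (Finset.disjoint_empty_right S) hA (by simp) hδ
  rw [Finset.union_empty] at hprod
  rw [hG.unique h_pos hprod, _root_.productState,
    Pi.single_eq_of_ne (mt (Bits.proj_eq_self_iff A s).mpr hs), mul_zero]

theorem restrict_groundSeries {h : Fin n → ℝ} (h_pos : ∀ j, 0 < h j) {V : Fin m → PauliString n}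
    {SA SB : Finset (Fin m)} {A : Finset (Fin n)} (hS : Disjoint SA SB)
    (hA : ∀ β ∈ SA, (V β).ActsWithin A) (hB : ∀ β ∈ SB, (V β).ActsWithin Aᶜ) (s : Bits n) :
    restrict (SA ∪ SB) (groundSeries h V s) =
      restrict SA (groundSeries h V (s.proj A)) * restrict SB (groundSeries h V (s.proj Aᶜ)) :=
  congrFun (SolvesEigen.unique h_pos ((groundSeries_solves h_pos V).restrict (SA ∪ SB))
    (((groundSeries_solves h_pos V).restrict SA).productState hS hA hB
      ((groundSeries_solves h_pos V).restrict SB))) s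

/-! ### Normalization -/

theorem normSqSeries_eq (h : Fin n → ℝ) (V : Fin m → PauliString n) :
    normSqSeries h V =
      ∑ s, map (starRingEnd ℂ) (groundSeries h V s) * groundSeries h V s := by
  ext k
  simp only [map_sum, coeff_mul]
  rw [Finset.sum_comm]
  rfl

theorem restrict_normSqSeries {h : Fin n → ℝ} (h_pos : ∀ j, 0 < h j) {V : Fin m → PauliString n}
    {SA SB : Finset (Fin m)} {A : Finset (Fin n)} (hS : Disjoint SA SB)
    (hA : ∀ β ∈ SA, (V β).ActsWithin A) (hB : ∀ β ∈ SB, (V β).ActsWithin Aᶜ) :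
    restrict (SA ∪ SB) (normSqSeries h V) =
      restrict SA (normSqSeries h V) * restrict SB (normSqSeries h V) := by
  have hr : ∀ S, restrict S (normSqSeries h V) = ∑ s,
      map (starRingEnd ℂ) (restrict S (groundSeries h V s)) * restrict S (groundSeries h V s) := by
    intro S
    simp only [normSqSeries_eq, map_sum, map_mul, restrict_map_star]
  rw [hr, hr, hr, ← sum_productState A]
  · refine Finset.sum_congr rfl fun s _ => ?_
    rw [restrict_groundSeries h_pos hS hA hB, productState, map_mul]
    ring
  · intro s hs
    rw [((groundSeries_solves h_pos V).restrict SA).eq_zero_of_proj_ne h_pos hA hs, mul_zero]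
  · intro s hs
    rw [((groundSeries_solves h_pos V).restrict SB).eq_zero_of_proj_ne h_pos hB hs, mul_zero]

theorem constantCoeff_groundSeries {h : Fin n → ℝ} (V : Fin m → PauliString n) (s : Bits n) :
    constantCoeff (groundSeries h V s) = if s = 0 then 1 else 0 := by
  change unnormalizedGround h V 0 s = _
  rw [← dysonMap_unnormalizedGround]
  by_cases hs : s = 0 <;> simp [dysonMap, reducedResolvent, perturb, ket, hs]

theorem constantCoeff_normSqSeries (h : Fin n → ℝ) (V : Fin m → PauliString n) :
    constantCoeff (normSqSeries h V) = 1 := by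
  simp [normSqSeries_eq, constantCoeff_groundSeries, constantCoeff_map]

/-- With `⟨Ẽ₀|Ẽ₀⟩ = 1 + x` viewed as the binomial series of exponent `1`, the exponents `-1/2`,
`-1/2` and `1` add up to `0`. -/
theorem normalizationSeries_sq_mul (h : Fin n → ℝ) (V : Fin m → PauliString n) :
    normalizationSeries h V ^ 2 * normSqSeries h V = 1 := by
  have hs : PowerSeries.HasSubst (normSqSeries h V - 1) :=
    PowerSeries.HasSubst.of_constantCoeff_zero (by
      rw [map_sub, constantCoeff_normSqSeries, map_one, sub_self])
  have hN : normSqSeries h V = PowerSeries.subst (normSqSeries h V - 1)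
      (PowerSeries.binomialSeries ℂ (1 : ℚ)) := by
    have := PowerSeries.binomialSeries_nat (R := ℚ) (A := ℂ) 1
    rw [Nat.cast_one] at this
    rw [this, pow_one, PowerSeries.subst_add hs, PowerSeries.subst_X hs,
      ← PowerSeries.coe_substAlgHom hs, map_one]
    ring
  calc normalizationSeries h V ^ 2 * normSqSeries h V
      = PowerSeries.subst (normSqSeries h V - 1) (PowerSeries.binomialSeries ℂ (-1 / 2 : ℚ) ^ 2 *
          PowerSeries.binomialSeries ℂ (1 : ℚ)) := by
        rw [PowerSeries.subst_mul hs, PowerSeries.subst_pow hs, ← hN, normalizationSeries]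
    _ = PowerSeries.subst (normSqSeries h V - 1) (1 : PowerSeries ℂ) := by
        rw [sq, ← PowerSeries.binomialSeries_add, ← PowerSeries.binomialSeries_add]
        norm_num
    _ = 1 := by rw [← PowerSeries.coe_substAlgHom hs, map_one]

theorem constantCoeff_normalizationSeries (h : Fin n → ℝ) (V : Fin m → PauliString n) :
    constantCoeff (normalizationSeries h V) = 1 := by
  have hc : constantCoeff (normSqSeries h V - 1) = 0 := by
    rw [map_sub, constantCoeff_normSqSeries, map_one, sub_self]
  have hs := PowerSeries.HasSubst.of_constantCoeff_zero hc
  have : PowerSeries.constantCoeff (PowerSeries.binomialSeries ℂ (-1 / 2 : ℚ) - 1) = 0 := by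
    rw [map_sub, PowerSeries.binomialSeries_constantCoeff, map_one, sub_self]
  have := PowerSeries.constantCoeff_subst_eq_zero hc _ this
  rw [PowerSeries.subst_sub hs, map_sub, sub_eq_zero] at this
  rw [normalizationSeries, this, ← PowerSeries.coe_substAlgHom hs, map_one, map_one]

/-- Both sides are inverse square roots, with constant coefficient `1`, of the same factorized norm;
uniqueness avoids any computation with binomial series. -/
theorem restrict_normalizationSeries {h : Fin n → ℝ} (h_pos : ∀ j, 0 < h j)
    {V : Fin m → PauliString n} {SA SB : Finset (Fin m)} {A : Finset (Fin n)}
    (hS : Disjoint SA SB) (hA : ∀ β ∈ SA, (V β).ActsWithin A)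
    (hB : ∀ β ∈ SB, (V β).ActsWithin Aᶜ) :
    restrict (SA ∪ SB) (normalizationSeries h V) =
      restrict SA (normalizationSeries h V) * restrict SB (normalizationSeries h V) := by
  have hsq : ∀ S, restrict S (normalizationSeries h V) ^ 2 * restrict S (normSqSeries h V) = 1 :=
    fun S => by rw [← map_pow, ← map_mul, normalizationSeries_sq_mul, map_one]
  refine eq_of_sq_mul_eq_one (hsq _) ?_ ?_ ?_
  · rw [restrict_normSqSeries h_pos hS hA hB, mul_pow, mul_mul_mul_comm, hsq, hsq, mul_one]
  · rw [constantCoeff_restrict, constantCoeff_normalizationSeries]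
  · rw [map_mul, constantCoeff_restrict, constantCoeff_restrict,
      constantCoeff_normalizationSeries, mul_one]

/-! ### Factorization of the normalized ground state. -/

theorem ground_eq_coeff (h : Fin n → ℝ) (V : Fin m → PauliString n) (k : Fin m →₀ ℕ)
    (s : Bits n) : ground h V k s = coeff k (normalizationSeries h V * groundSeries h V s) := by
  rw [ground, Finset.sum_apply, coeff_mul]
  rfl

/-- The normalized ground state factorizes over complementary regions. -/
theorem ground_add {h : Fin n → ℝ} (h_pos : ∀ j, 0 < h j) {V : Fin m → PauliString n}
    {A : Finset (Fin n)} {kA kB : Fin m →₀ ℕ} (hk : Disjoint kA.support kB.support)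
    (hA : ∀ β ∈ kA.support, (V β).ActsWithin A) (hB : ∀ β ∈ kB.support, (V β).ActsWithin Aᶜ)
    (s : Bits n) :
    ground h V (kA + kB) s = ground h V kA (s.proj A) * ground h V kB (s.proj Aᶜ) := by
  rw [ground_eq_coeff, ground_eq_coeff, ground_eq_coeff]
  refine coeff_add_of_restrict_union_eq_mul hk ?_ subset_rfl subset_rfl
  rw [map_mul, map_mul, map_mul, restrict_groundSeries h_pos hk hA hB,
    restrict_normalizationSeries h_pos hk hA hB]
  ring

/-- A perturbation proportional to the identity does not change the ground state. -/
theorem ground_eq_zero_of_trivial {h : Fin n → ℝ} (h_pos : ∀ j, 0 < h j)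
    {V : Fin m → PauliString n} {k : Fin m →₀ ℕ} {β : Fin m} (hβ : ∀ j, V β j = Pauli.I)
    (hk : k β ≠ 0) (s : Bits n) : ground h V k s = 0 := by
  have hA : ∀ γ ∈ ({β} : Finset (Fin m)), (V γ).ActsWithin ∅ := by
    intro γ hγ j _
    rw [Finset.mem_singleton.mp hγ, hβ]
  have hsol := (groundSeries_solves h_pos V).restrict {β}
  -- With only `β` switched on nothing leaves `|0⟩`: the region acted on is empty, so all other
  -- components vanish.
  have hN : restrict {β} (normSqSeries h V) = 1 := by
    rw [normSqSeries_eq, map_sum, Finset.sum_eq_single 0]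
    · rw [map_mul, restrict_map_star, hsol.normalized]
      simp
    · intro t _ ht
      rw [map_mul, hsol.eq_zero_of_proj_ne h_pos hA, mul_zero]
      intro e
      exact ht (e.symm.trans (by funext j; simp [Bits.proj]))
    · simp
  have hν : restrict {β} (normalizationSeries h V) = 1 := by
    refine eq_of_sq_mul_eq_one (N := 1) ?_ (by simp) ?_ (by simp)
    · rw [← hN, ← map_pow, ← map_mul, normalizationSeries_sq_mul, map_one, hN]
    · rw [constantCoeff_restrict, constantCoeff_normalizationSeries]
  -- Factorization with the empty region splits off the power of `J_β`, whose coefficient in the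
  -- constant series `1` is zero.
  have hdec : Finsupp.single β (k β) + k.erase β = k := Finsupp.single_add_erase β k
  have hsupp : (Finsupp.single β (k β)).support = {β} := Finsupp.support_single β hk
  rw [← hdec, ground_add (A := ∅) h_pos]
  · have h0 : s.proj ∅ = 0 := by funext j; simp [Bits.proj]
    have : ground h V (Finsupp.single β (k β)) (s.proj ∅) = 0 := by
      rw [h0, ground_eq_coeff]
      have e : coeff (Finsupp.single β (k β)) (restrict {β}
          (normalizationSeries h V * groundSeries h V 0)) = 0 := by
        rw [map_mul, hν, hsol.normalized, mul_one, coeff_one, if_neg]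
        simpa using hk
      rwa [coeff_restrict, if_pos hsupp.subset] at e
    rw [this, zero_mul]
  · rw [hsupp]; simp
  · rwa [hsupp]
  · intro γ _ j hj; simp at hj

end ground_series

/-! ### Factorization of the ground state coefficients -/

section ground_coeff

variable {n m : ℕ}

theorem PauliString.toOp_mulVec (P : PauliString n) (ψ : QState n) : P.toOp *ᵥ ψ = P.act ψ := rfl

theorem PauliString.ActsWithin.toOp_pow_mulVec_productState {P : PauliString n}
    {A : Finset (Fin n)} (hP : P.ActsWithin A) (r : ℕ) (a b : QState n) :
    P.toOp ^ r *ᵥ productState A a b = productState A (P.toOp ^ r *ᵥ a) b := by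
  induction r with
  | zero => simp
  | succ r ih =>
    rw [pow_succ', ← Matrix.mulVec_mulVec, ← Matrix.mulVec_mulVec, ih, PauliString.toOp_mulVec,
      hP.act_productState, PauliString.toOp_mulVec]

theorem PauliString.ActsWithin.toOp_pow_mulVec_productState_compl {P : PauliString n}
    {A : Finset (Fin n)} (hP : P.ActsWithin Aᶜ) (r : ℕ) (a b : QState n) :
    P.toOp ^ r *ᵥ productState A a b = productState A a (P.toOp ^ r *ᵥ b) := by
  rw [← productState_compl, hP.toOp_pow_mulVec_productState, productState_compl]

theorem productState_ket_zero (A : Finset (Fin n)) :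
    productState A (ket 0) (ket 0) = (ket 0 : QState n) := by
  funext s
  by_cases hs : s = 0
  · simp [hs, productState, Bits.proj_zero, ket]
  · by_cases h : s.proj A = 0
    · have : s.proj Aᶜ ≠ 0 := fun h' => hs (by rw [← Bits.proj_add_proj_compl A s, h, h', add_zero])
      simp [productState, ket, hs, this]
    · simp [productState, ket, hs, h]

/-- Each index has a nonzero exponent in at most one of `kA`, `kB`, so each factor of the ordered
product acts on one side only and nothing has to be commuted. -/
theorem opMonomial_add_mulVec {V : Fin m → PauliString n} {A : Finset (Fin n)}
    {kA kB : Fin m →₀ ℕ} (hk : Disjoint kA.support kB.support)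
    (hA : ∀ β ∈ kA.support, (V β).ActsWithin A) (hB : ∀ β ∈ kB.support, (V β).ActsWithin Aᶜ) :
    opMonomial V (kA + kB) *ᵥ ket 0 =
      productState A (opMonomial V kA *ᵥ ket 0) (opMonomial V kB *ᵥ ket 0) := by
  have key : ∀ (l : List (Fin m)) (a b : QState n),
      (l.map fun i => (V i).toOp ^ (kA + kB) i).reverse.prod *ᵥ productState A a b =
        productState A ((l.map fun i => (V i).toOp ^ kA i).reverse.prod *ᵥ a)
          ((l.map fun i => (V i).toOp ^ kB i).reverse.prod *ᵥ b) := by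
    intro l
    induction l with
    | nil => intro a b; simp
    | cons i l ih =>
      intro a b
      simp only [List.map_cons, List.reverse_cons, List.prod_append, List.prod_cons, List.prod_nil,
        mul_one, ← Matrix.mulVec_mulVec]
      by_cases hi : i ∈ kA.support
      · have hi' : kB i = 0 := Finsupp.notMem_support_iff.mp (Finset.disjoint_left.mp hk hi)
        rw [Finsupp.add_apply, hi', add_zero, (hA i hi).toOp_pow_mulVec_productState, ih, pow_zero,
          Matrix.one_mulVec]
      · rw [Finsupp.add_apply, Finsupp.notMem_support_iff.mp hi, zero_add, pow_zero,
          Matrix.one_mulVec]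
        by_cases hi' : i ∈ kB.support
        · rw [(hB i hi').toOp_pow_mulVec_productState_compl, ih]
        · rw [Finsupp.notMem_support_iff.mp hi', pow_zero, Matrix.one_mulVec, Matrix.one_mulVec, ih]
  have := key (List.finRange m) (ket 0) (ket 0)
  rw [productState_ket_zero, ← List.ofFn_eq_map, ← List.ofFn_eq_map, ← List.ofFn_eq_map] at this
  exact this

theorem stateLabel_proj {V : Fin m → PauliString n} {A : Finset (Fin n)} {k : Fin m →₀ ℕ}
    (hA : ∀ β ∈ k.support, (V β).ActsWithin A) : (stateLabel V k).proj A = stateLabel V k := by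
  funext j
  by_cases hj : j ∈ A
  · simp [Bits.proj, hj]
  · simp only [Bits.proj, hj, if_false, stateLabel, Finset.sum_apply, Pi.smul_apply]
    refine (Finset.sum_eq_zero fun β _ => ?_).symm
    by_cases hβ : β ∈ k.support
    · rw [PauliString.flips, hA β hβ j hj, Pauli.flip, smul_zero]
    · rw [Finsupp.notMem_support_iff.mp hβ, zero_smul]

theorem opMonomial_mulVec_eq_zero {V : Fin m → PauliString n} {A : Finset (Fin n)}
    {k : Fin m →₀ ℕ} (hA : ∀ β ∈ k.support, (V β).ActsWithin A) {s : Bits n} (hs : s.proj A ≠ s) :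
    (opMonomial V k *ᵥ ket 0) s = 0 := by
  obtain ⟨g, hg⟩ := opMonomial_mulVec_ket_zero V k
  have : s ≠ stateLabel V k := by
    rintro rfl
    exact hs (stateLabel_proj hA)
  rw [hg]
  simp [ket, this]

theorem groundCoeff_add {h : Fin n → ℝ} (h_pos : ∀ j, 0 < h j) {V : Fin m → PauliString n}
    {A : Finset (Fin n)} {kA kB : Fin m →₀ ℕ} (hk : Disjoint kA.support kB.support)
    (hA : ∀ β ∈ kA.support, (V β).ActsWithin A) (hB : ∀ β ∈ kB.support, (V β).ActsWithin Aᶜ) :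
    groundCoeff h V (kA + kB) = groundCoeff h V kA * groundCoeff h V kB := by
  simp only [groundCoeff, dotProduct]
  rw [← sum_productState A]
  · refine Finset.sum_congr rfl fun s _ => ?_
    rw [ground_add h_pos hk hA hB, Pi.star_apply, opMonomial_add_mulVec hk hA hB, productState,
      productState, star_mul', Pi.star_apply, Pi.star_apply]
    ring
  · intro s hs
    rw [Pi.star_apply, opMonomial_mulVec_eq_zero hA hs, star_zero, zero_mul]
  · intro s hs
    rw [Pi.star_apply, opMonomial_mulVec_eq_zero hB hs, star_zero, zero_mul]

theorem groundCoeff_eq_zero_of_trivial {h : Fin n → ℝ} (h_pos : ∀ j, 0 < h j)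
    {V : Fin m → PauliString n} {k : Fin m →₀ ℕ} {β : Fin m} (hβ : ∀ j, V β j = Pauli.I)
    (hk : k β ≠ 0) : groundCoeff h V k = 0 :=
  Finset.sum_eq_zero fun s _ => by rw [ground_eq_zero_of_trivial h_pos hβ hk, mul_zero]

theorem mem_indexSupport_of_stateLabel_ne_zero {V : Fin m → PauliString n} {k : Fin m →₀ ℕ}
    {j : Fin n} (hj : stateLabel V k j ≠ 0) : j ∈ indexSupport V k := by
  by_contra hn
  apply hj
  rw [stateLabel, Finset.sum_apply]
  refine Finset.sum_eq_zero fun i _ => ?_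
  by_cases hi : k i = 0
  · rw [hi, zero_smul, Pi.zero_apply]
  · have : V i j = Pauli.I := by
      by_contra hI
      exact hn ⟨i, hi, hI⟩
    rw [Pi.smul_apply, PauliString.flips, this, Pauli.flip, smul_zero]

theorem indexSupport_mono (V : Fin m → PauliString n) {k k' : Fin m →₀ ℕ} (hk : k ≤ k') :
    indexSupport V k ⊆ indexSupport V k' := by
  rintro j ⟨i, hi, hij⟩
  have := hk i
  exact ⟨i, by omega, hij⟩

end ground_coeff

/-! ### Factorization of the expansion of the ansatz -/

section expansion

variable {n m p : ℕ}

theorem totalPower_add (f f' : ExpIndex m p) :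
    totalPower (f + f') = totalPower f + totalPower f' :=
  Finsupp.sum_add_index' (fun _ => rfl) fun _ _ _ => rfl

theorem totalOrder_add (f f' : ExpIndex m p) :
    totalOrder (f + f') = totalOrder f + totalOrder f' :=
  Finsupp.sum_add_index' (fun _ => by simp) fun _ _ _ => by rw [map_add, add_smul]

/-- Disjointness is what keeps the factorials in the denominators multiplicative. -/
theorem thetaWeight_add (θ : Fin p → (Fin m →₀ ℕ) → ℝ) {f f' : ExpIndex m p}
    (hf : Disjoint f.support f'.support) :
    thetaWeight θ (f + f') = thetaWeight θ f * thetaWeight θ f' :=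
  Finsupp.prod_add_index_of_disjoint hf _

theorem thetaWeight_eq_zero {θ : Fin p → (Fin m →₀ ℕ) → ℝ} {f : ExpIndex m p}
    {k : Fin m →₀ ℕ} {i : Fin p} (hf : f k i ≠ 0) (hθ : θ i k = 0) : thetaWeight θ f = 0 := by
  refine Finset.prod_eq_zero (i := k) ?_ (Finset.prod_eq_zero (Finset.mem_univ i) ?_)
  · rw [Finsupp.mem_support_iff]
    intro h
    rw [h] at hf
    exact hf rfl
  · rw [hθ, zero_pow hf, zero_div]

theorem degree_smul_le_totalOrder (f : ExpIndex m p) (k : Fin m →₀ ℕ) :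
    (f k).degree • k ≤ totalOrder f := by
  by_cases hk : k ∈ f.support
  · exact Finset.single_le_sum (f := fun k => (f k).degree • k) (fun _ _ => zero_le) hk
  · rw [Finsupp.notMem_support_iff.mp hk, map_zero, zero_smul]
    exact zero_le

theorem le_totalOrder {f : ExpIndex m p} {k : Fin m →₀ ℕ} (hk : f k ≠ 0) : k ≤ totalOrder f := by
  refine le_trans ?_ (degree_smul_le_totalOrder f k)
  have : 1 ≤ (f k).degree := by
    rw [Nat.one_le_iff_ne_zero]
    exact mt (Finsupp.degree_eq_zero_iff _).mp hk
  calc k = 1 • k := (one_smul _ _).symm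
    _ ≤ (f k).degree • k := nsmul_le_nsmul_left zero_le this

/-- The indices of the nonzero terms of order `k` in the expansion of the ansatz. -/
def admissibleSet (θ : Fin p → (Fin m →₀ ℕ) → ℝ) (k : Fin m →₀ ℕ) : Set (ExpIndex m p) :=
  {f | totalOrder f = k ∧ thetaWeight θ f ≠ 0}

theorem theta_ne_zero_of_mem_admissibleSet {θ : Fin p → (Fin m →₀ ℕ) → ℝ} {k : Fin m →₀ ℕ}
    {f : ExpIndex m p} (hf : f ∈ admissibleSet θ k) {k' : Fin m →₀ ℕ} {i : Fin p}
    (hi : f k' i ≠ 0) : θ i k' ≠ 0 := fun h => hf.2 (thetaWeight_eq_zero hi h)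

theorem le_of_mem_admissibleSet {θ : Fin p → (Fin m →₀ ℕ) → ℝ} {k : Fin m →₀ ℕ}
    {f : ExpIndex m p} (hf : f ∈ admissibleSet θ k) {k' : Fin m →₀ ℕ} (hk : f k' ≠ 0) :
    k' ≤ k := hf.1 ▸ le_totalOrder hk

theorem ne_zero_of_mem_admissibleSet {θ : Fin p → (Fin m →₀ ℕ) → ℝ} (hθ : ∀ i, θ i 0 = 0)
    {k : Fin m →₀ ℕ} {f : ExpIndex m p} (hf : f ∈ admissibleSet θ k) {k' : Fin m →₀ ℕ}
    (hk : f k' ≠ 0) : k' ≠ 0 := by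
  rintro rfl
  obtain ⟨i, hi⟩ := DFunLike.ne_iff.mp hk
  exact theta_ne_zero_of_mem_admissibleSet hf hi (hθ i)

theorem admissibleSet_finite {θ : Fin p → (Fin m →₀ ℕ) → ℝ} (hθ : ∀ i, θ i 0 = 0)
    (k : Fin m →₀ ℕ) : (admissibleSet θ k).Finite := by
  -- Only orders `0 ≠ k' ≤ k` occur, and each power is at most `k.degree` because every factor adds
  -- at least `1` to the total degree. Excluding order `0` is where `hθ` enters.
  refine (Set.finite_Icc (0 : ExpIndex m p) (∑ k' ∈ Finset.Icc 0 k,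
    Finsupp.single k' (Finsupp.equivFunOnFinite.symm fun _ => k.degree))).subset fun f hf => ?_
  refine ⟨zero_le, fun k' => ?_⟩
  by_cases hk : f k' = 0
  · rw [hk]; exact zero_le
  · have hle := le_of_mem_admissibleSet hf hk
    have hne := ne_zero_of_mem_admissibleSet hθ hf hk
    rw [Finsupp.finsetSum_apply, Finset.sum_eq_single k']
    · rw [Finsupp.single_eq_same]
      intro i
      rw [Finsupp.coe_equivFunOnFinite_symm]
      have h1 : f k' i ≤ (f k').degree := Finsupp.le_degree i _
      have h2 := Finsupp.degree_mono (degree_smul_le_totalOrder f k')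
      have h3 : k'.degree ≠ 0 := mt (Finsupp.degree_eq_zero_iff _).mp hne
      rw [hf.1, map_nsmul, smul_eq_mul] at h2
      exact h1.trans ((Nat.le_mul_of_pos_right _ (Nat.pos_of_ne_zero h3)).trans h2)
    · intro q _ hq
      rw [Finsupp.single_eq_of_ne hq.symm]
    · intro h
      exact absurd (Finset.mem_Icc.mpr ⟨zero_le, hle⟩) h

/-- A single term of `ansatzCoeff`. -/
def ansatzTerm (V : Fin m → PauliString n) (T : Fin p → PauliString n)
    (θ : Fin p → (Fin m →₀ ℕ) → ℝ) (k : Fin m →₀ ℕ) (f : ExpIndex m p) : ℂ :=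
  Complex.I ^ (totalPower f).degree * (thetaWeight θ f : ℂ) * amplitude V T k f

theorem ansatzCoeff_eq_sum (V : Fin m → PauliString n) (T : Fin p → PauliString n)
    {θ : Fin p → (Fin m →₀ ℕ) → ℝ} (hθ : ∀ i, θ i 0 = 0) (k : Fin m →₀ ℕ) :
    ansatzCoeff V T θ k = ∑ f ∈ (admissibleSet_finite hθ k).toFinset, ansatzTerm V T θ k f := by
  refine finsum_mem_eq_sum_of_inter_support_eq (s := {f | totalOrder f = k})
    (ansatzTerm V T θ k) ?_
  ext f
  simp only [Set.mem_inter_iff, Set.mem_ofPred_eq, Set.Finite.coe_toFinset, admissibleSet]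
  constructor
  · rintro ⟨h1, h2⟩
    refine ⟨⟨h1, fun h => h2 ?_⟩, h2⟩
    rw [ansatzTerm, h, Complex.ofReal_zero, mul_zero, zero_mul]
  · rintro ⟨⟨h1, _⟩, h2⟩
    exact ⟨h1, h2⟩

/-! ### Terms that involve a parameter of the full order. -/

/-- The index of the term that is linear in `θ i k`. -/
def linearIndex (k : Fin m →₀ ℕ) (i : Fin p) : ExpIndex m p :=
  Finsupp.single k (Finsupp.single i 1)

theorem totalOrder_linearIndex (k : Fin m →₀ ℕ) (i : Fin p) :
    totalOrder (linearIndex k i) = k := by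
  rw [totalOrder, linearIndex, Finsupp.sum_single_index] <;> simp

theorem totalPower_linearIndex (k : Fin m →₀ ℕ) (i : Fin p) :
    totalPower (linearIndex k i) = Finsupp.single i 1 := by
  rw [totalPower, linearIndex, Finsupp.sum_single_index rfl]

theorem thetaWeight_linearIndex (θ : Fin p → (Fin m →₀ ℕ) → ℝ) (k : Fin m →₀ ℕ) (i : Fin p) :
    thetaWeight θ (linearIndex k i) = θ i k := by
  rw [thetaWeight, linearIndex, Finsupp.prod_single_index (by simp), Finset.prod_eq_single i]
  · simp
  · intro j _ hj
    simp [Finsupp.single_eq_of_ne hj]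
  · simp

/-- One factor of order `k` exhausts the total order, and the rest would consist of parameters of
order `0`, which vanish. -/
theorem eq_linearIndex_of_mem_admissibleSet {θ : Fin p → (Fin m →₀ ℕ) → ℝ} (hθ : ∀ i, θ i 0 = 0)
    {k : Fin m →₀ ℕ} {f : ExpIndex m p} (hf : f ∈ admissibleSet θ k) (hk : f k ≠ 0) :
    ∃ i, f = linearIndex k i := by
  obtain ⟨i, hi⟩ := DFunLike.ne_iff.mp hk
  have hle : linearIndex k i ≤ f := by
    rw [linearIndex, Finsupp.single_le_iff, Finsupp.single_le_iff]
    exact Nat.one_le_iff_ne_zero.mpr hi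
  have e := tsub_add_cancel_of_le hle
  have hr : totalOrder (f - linearIndex k i) = 0 := by
    have := congrArg totalOrder e
    rw [totalOrder_add, totalOrder_linearIndex, hf.1] at this
    exact add_eq_right.mp this
  refine ⟨i, ?_⟩
  suffices h0 : f - linearIndex k i = 0 by rw [← e, h0, zero_add]
  ext k' : 1
  by_contra hne
  have h0 : k' = 0 := le_antisymm (hr ▸ le_totalOrder hne) zero_le
  refine ne_zero_of_mem_admissibleSet hθ hf (k' := k') (fun h => hne ?_) h0
  rw [Finsupp.tsub_apply, h, zero_tsub, Finsupp.zero_apply]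

theorem opMonomial_single (T : Fin p → PauliString n) (i : Fin p) :
    opMonomial T (Finsupp.single i 1) = (T i).toOp := by
  have key : ∀ l : List (Fin p), l.Nodup →
      (l.map fun j => (T j).toOp ^ (Finsupp.single i 1 : Fin p →₀ ℕ) j).reverse.prod =
        if i ∈ l then (T i).toOp else 1 := by
    intro l
    induction l with
    | nil => intro _; simp
    | cons j l ih =>
      intro hl
      rw [List.nodup_cons] at hl
      simp only [List.map_cons, List.reverse_cons, List.prod_append, List.prod_cons, List.prod_nil,
        mul_one, ih hl.2]
      by_cases hj : j = i
      · subst hj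
        simp [hl.1]
      · rw [Finsupp.single_eq_of_ne hj, pow_zero, mul_one]
        simp [Ne.symm hj]
  have := key (List.finRange p) (List.nodup_finRange p)
  rw [← List.ofFn_eq_map, if_pos (List.mem_finRange i)] at this
  exact this

open Classical in
/-- The part of the expansion that is linear in the parameters of the same order. -/
theorem sum_linear_ansatzTerm (V : Fin m → PauliString n) (T : Fin p → PauliString n)
    {θ : Fin p → (Fin m →₀ ℕ) → ℝ} (hθ : ∀ i, θ i 0 = 0) (k : Fin m →₀ ℕ) :
    ∑ f ∈ (admissibleSet_finite hθ k).toFinset with f k ≠ 0, ansatzTerm V T θ k f =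
      ∑ i, Complex.I * (θ i k : ℂ) *
        (star (opMonomial V k *ᵥ ket 0) ⬝ᵥ ((T i).toOp *ᵥ ket 0)) := by
  have ht : ∀ i, ansatzTerm V T θ k (linearIndex k i) = Complex.I * (θ i k : ℂ) *
      (star (opMonomial V k *ᵥ ket 0) ⬝ᵥ ((T i).toOp *ᵥ ket 0)) := by
    intro i
    rw [ansatzTerm, amplitude, totalPower_linearIndex, opMonomial_single,
      thetaWeight_linearIndex, Finsupp.degree_single, pow_one]
  have hinj : Function.Injective (linearIndex k : Fin p → ExpIndex m p) := by
    intro i j hij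
    have := congrArg totalPower hij
    rw [totalPower_linearIndex, totalPower_linearIndex] at this
    exact Finsupp.single_left_injective one_ne_zero this
  -- For `θ i k = 0` the linear index is not admissible, so these `i` are dropped before matching
  -- the two sums.
  rw [← Finset.sum_filter_of_ne (p := fun i => θ i k ≠ 0) (s := Finset.univ)]
  · symm
    refine Finset.sum_of_injOn (linearIndex k) hinj.injOn ?_ ?_ fun i _ => (ht i).symm
    · intro i hi
      simp only [Finset.coe_filter, Finset.mem_univ, true_and, Set.mem_ofPred_eq] at hi
      simp only [Finset.coe_filter, Set.Finite.mem_toFinset, Set.mem_ofPred_eq, admissibleSet]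
      refine ⟨⟨totalOrder_linearIndex k i, ?_⟩, ?_⟩
      · rwa [thetaWeight_linearIndex]
      · simp [linearIndex]
    · intro f hf hn
      simp only [Finset.mem_filter, Set.Finite.mem_toFinset] at hf
      obtain ⟨i, rfl⟩ := eq_linearIndex_of_mem_admissibleSet hθ hf.1 hf.2
      refine absurd ⟨i, ?_, rfl⟩ hn
      have := hf.1.2
      rw [thetaWeight_linearIndex] at this
      simpa using this
  · intro i _ h h0
    apply h
    rw [h0]
    simp

end expansion

/-! ### The hierarchy of equations -/

section hierarchy

theorem degree_lt_degree {m : ℕ} {k k' : Fin m →₀ ℕ} (hk : k < k') : k.degree < k'.degree := by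
  have e := tsub_add_cancel_of_le hk.le
  have h0 : (k' - k).degree ≠ 0 := fun h =>
    hk.not_ge (tsub_eq_zero_iff_le.mp ((Finsupp.degree_eq_zero_iff _).mp h))
  rw [← e, map_add]
  omega

variable {n m p : ℕ} {h : Fin n → ℝ} {V : Fin m → PauliString n} {T : Fin p → PauliString n}
  {gen : Bits n → Fin 2 → Option (Fin p)} {θ : Fin p → (Fin m →₀ ℕ) → ℝ}

theorem IsGenerating.flips_eq (hg : IsGenerating T gen) {s : Bits n} {a : Fin 2} {i : Fin p}
    (hi : gen s a = some i) : (T i).flips = s := by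
  obtain ⟨g, e⟩ := (T i).toOp_mulVec_ket 0
  rw [hg.acts s a i hi, zero_add] at e
  by_contra hne
  have := congrFun e s
  simp [ket, Ne.symm hne] at this

/-- If the linear part of the equation of order `k` vanishes, so do the parameters. -/
theorem SolvesFixingEquations.eq_zero_of_linear (hg : IsGenerating T gen)
    (hθ : SolvesFixingEquations h V T gen θ) {k : Fin m →₀ ℕ}
    (hk : ∑ i, Complex.I * (θ i k : ℂ) *
      (star (opMonomial V k *ᵥ ket 0) ⬝ᵥ ((T i).toOp *ᵥ ket 0)) = 0) (i : Fin p) :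
    θ i k = 0 := by
  obtain ⟨g, hv⟩ := opMonomial_mulVec_ket_zero V k
  set s := stateLabel V k
  -- The common phase of `V^k |0⟩` is divided out.
  have hsum : ∑ j, (θ j k : ℂ) * ((T j).toOp *ᵥ ket 0) s = 0 := by
    have hne : Complex.I * star (Complex.I ^ g) ≠ 0 := by simp
    refine (mul_eq_zero.mp ?_).resolve_left hne
    rw [← hk, Finset.mul_sum]
    refine Finset.sum_congr rfl fun j _ => ?_
    rw [hv, star_smul, smul_dotProduct]
    have : star (ket s) ⬝ᵥ ((T j).toOp *ᵥ ket 0) = ((T j).toOp *ᵥ ket 0) s := by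
      rw [dotProduct, Finset.sum_eq_single s]
      · simp [ket]
      · intro t _ ht
        simp [ket, ht]
      · simp
    rw [this, smul_eq_mul]
    ring
  by_contra hi
  obtain ⟨a, ha⟩ := hθ.only_diagrams i k hi
  have hact : ∀ j b, gen s b = some j → ((T j).toOp *ᵥ ket 0) s = Complex.I ^ (b : ℕ) := by
    intro j b hj
    rw [hg.acts s b j hj]
    simp [ket]
  have hcases : ∀ b : Fin 2, b = 0 ∨ b = 1 := by decide
  -- The generators with `a = 0` and `a = 1` have amplitudes `1` and `i`, so the real and the
  -- imaginary part of `hsum` each isolate one real parameter.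
  rcases hcases a with rfl | rfl
  · have hre := congrArg Complex.re hsum
    rw [Complex.re_sum, Finset.sum_eq_single i] at hre
    · rw [hact i 0 ha] at hre
      simp [hi] at hre
    · intro j _ hj
      by_cases hz : θ j k = 0
      · simp [hz]
      · obtain ⟨b, hb⟩ := hθ.only_diagrams j k hz
        rcases hcases b with rfl | rfl
        · exact absurd (Option.some_injective _ (hb.symm.trans ha)) hj
        · rw [hact j 1 hb]
          simp
    · simp
  · have him := congrArg Complex.im hsum
    rw [Complex.im_sum, Finset.sum_eq_single i] at him
    · rw [hact i 1 ha] at him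
      simp [hi] at him
    · intro j _ hj
      by_cases hz : θ j k = 0
      · simp [hz]
      · obtain ⟨b, hb⟩ := hθ.only_diagrams j k hz
        rcases hcases b with rfl | rfl
        · rw [hact j 0 hb]
          simp
        · exact absurd (Option.some_injective _ (hb.symm.trans ha)) hj
    · simp

open Classical in
/-- If the nonlinear part of the expansion at order `k` already gives the ground state
coefficient, the parameters of order `k` vanish. -/
theorem SolvesFixingEquations.eq_zero_of_nonlinear (hg : IsGenerating T gen)
    (hθ : SolvesFixingEquations h V T gen θ) {k : Fin m →₀ ℕ}
    (hk : ∑ f ∈ (admissibleSet_finite hθ.zero_order k).toFinset with f k = 0,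
      ansatzTerm V T θ k f = groundCoeff h V k) (i : Fin p) : θ i k = 0 := by
  refine hθ.eq_zero_of_linear hg ?_ i
  have e := hθ.fixing k
  rw [ansatzCoeff_eq_sum V T hθ.zero_order,
    ← Finset.sum_filter_add_sum_filter_not _ (fun f => f k = 0), hk] at e
  rw [← sum_linear_ansatzTerm V T hθ.zero_order]
  linear_combination -e

/-- Any nonlinear term must contain a parameter of lower order that also involves `β`, which
vanishes by induction. Since `C_k = 0` too, only the linear part is left. -/
theorem SolvesFixingEquations.eq_zero_of_trivial (h_pos : ∀ j, 0 < h j) (hg : IsGenerating T gen)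
    (hθ : SolvesFixingEquations h V T gen θ) {β : Fin m} (hβ : ∀ j, V β j = Pauli.I)
    (k : Fin m →₀ ℕ) (hk : k β ≠ 0) (i : Fin p) : θ i k = 0 := by
  classical
  induction hd : k.degree using Nat.strong_induction_on generalizing k i with
  | _ d ih =>
    refine hθ.eq_zero_of_nonlinear hg ?_ i
    rw [groundCoeff_eq_zero_of_trivial h_pos hβ hk]
    refine Finset.sum_eq_zero fun f hf => ?_
    exfalso
    simp only [Finset.mem_filter, Set.Finite.mem_toFinset] at hf
    obtain ⟨hf, hfk⟩ := hf
    rw [← hf.1, totalOrder, Finsupp.sum, Finsupp.finsetSum_apply] at hk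
    obtain ⟨k', hk', hne⟩ := Finset.exists_ne_zero_of_sum_ne_zero hk
    rw [Finsupp.smul_apply, smul_eq_mul] at hne
    have hf' := Finsupp.mem_support_iff.mp hk'
    obtain ⟨i', hi'⟩ := DFunLike.ne_iff.mp hf'
    have hlt : k' < k := lt_of_le_of_ne (le_of_mem_admissibleSet hf hf') (by
      rintro rfl
      exact hf' hfk)
    exact theta_ne_zero_of_mem_admissibleSet hf hi'
      (ih _ (hd ▸ degree_lt_degree hlt) k' (right_ne_zero_of_mul hne) i' rfl)

/-- A generator occurring in `f` flips exactly the bits of some `s(k')` with `k' ≤ k`, and these lie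
in the support of `k`. Hence matching applies as soon as the supports of the orders are disjoint. -/
theorem SolvesFixingEquations.actedRegion_eq (hg : IsGenerating T gen)
    (hθ : SolvesFixingEquations h V T gen θ) {k : Fin m →₀ ℕ} {f : ExpIndex m p}
    (hf : f ∈ admissibleSet θ k) : actedRegion V T k f = indexSupport V k := by
  refine Set.union_eq_self_of_subset_right ?_
  rintro j ⟨i, hi, hj⟩
  rw [totalPower, Finsupp.sum, Finsupp.finsetSum_apply] at hi
  obtain ⟨k', hk', hne⟩ := Finset.exists_ne_zero_of_sum_ne_zero hi
  obtain ⟨a, ha⟩ := hθ.only_diagrams i k' (theta_ne_zero_of_mem_admissibleSet hf hne)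
  refine indexSupport_mono V (le_of_mem_admissibleSet hf (Finsupp.mem_support_iff.mp hk')) ?_
  apply mem_indexSupport_of_stateLabel_ne_zero
  rw [← hg.flips_eq ha, hj]
  exact one_ne_zero

theorem not_le_of_disjoint_support {kA kB k' : Fin m →₀ ℕ} (hk : Disjoint kA.support kB.support)
    (h0 : k' ≠ 0) (hA : k' ≤ kA) : ¬ k' ≤ kB := by
  intro hB
  apply h0
  ext i
  have h1 := hA i
  have h2 := hB i
  by_cases hi : i ∈ kA.support
  · have := Finsupp.notMem_support_iff.mp (Finset.disjoint_left.mp hk hi)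
    simp; omega
  · have := Finsupp.notMem_support_iff.mp hi
    simp; omega

/-- No nonzero order lies below both `kA` and `kB`, so `f` and `f'` share no parameter and the
weights multiply; matching handles the amplitudes. -/
theorem SolvesFixingEquations.ansatzTerm_add (hg : IsGenerating T gen) (hm : IsMatched V T)
    (hθ : SolvesFixingEquations h V T gen θ) {kA kB : Fin m →₀ ℕ}
    (hk : Disjoint kA.support kB.support)
    (hV : Disjoint (indexSupport V kA) (indexSupport V kB)) {f f' : ExpIndex m p}
    (hf : f ∈ admissibleSet θ kA) (hf' : f' ∈ admissibleSet θ kB) :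
    Disjoint f.support f'.support ∧
    ansatzTerm V T θ (kA + kB) (f + f') = ansatzTerm V T θ kA f * ansatzTerm V T θ kB f' := by
  have hd : Disjoint f.support f'.support := by
    rw [Finset.disjoint_left]
    intro k' h1 h2
    rw [Finsupp.mem_support_iff] at h1 h2
    exact not_le_of_disjoint_support hk (ne_zero_of_mem_admissibleSet hθ.zero_order hf h1)
      (le_of_mem_admissibleSet hf h1) (le_of_mem_admissibleSet hf' h2)
  refine ⟨hd, ?_⟩
  rw [ansatzTerm, ansatzTerm, ansatzTerm, totalPower_add, thetaWeight_add θ hd, map_add, pow_add,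
    ← hm]
  · push_cast
    ring
  · rwa [hθ.actedRegion_eq hg hf, hθ.actedRegion_eq hg hf']

theorem eq_and_eq_of_add_eq {a b c d : Fin m →₀ ℕ} (hcd : Disjoint c.support d.support)
    (ha : a.support ⊆ c.support) (hb : b.support ⊆ d.support) (e : a + b = c + d) :
    a = c ∧ b = d := by
  have key : ∀ i, a i = c i ∧ b i = d i := by
    intro i
    have ei := DFunLike.congr_fun e i
    simp only [Finsupp.add_apply] at ei
    by_cases hi : i ∈ c.support
    · have h1 := Finset.disjoint_left.mp hcd hi
      have h2 := Finsupp.notMem_support_iff.mp h1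
      have h3 := Finsupp.notMem_support_iff.mp fun h => h1 (hb h)
      omega
    · have h2 := Finsupp.notMem_support_iff.mp hi
      have h3 := Finsupp.notMem_support_iff.mp fun h => hi (ha h)
      omega
  exact ⟨Finsupp.ext fun i => (key i).1, Finsupp.ext fun i => (key i).2⟩

theorem support_totalOrder_subset {f : ExpIndex m p} {k : Fin m →₀ ℕ}
    (hf : ∀ k', f k' ≠ 0 → k' ≤ k) : (totalOrder f).support ⊆ k.support := by
  intro i hi
  rw [Finsupp.mem_support_iff] at hi ⊢
  rw [totalOrder, Finsupp.sum, Finsupp.finsetSum_apply] at hi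
  obtain ⟨k', hk', hne⟩ := Finset.exists_ne_zero_of_sum_ne_zero hi
  have := hf k' (Finsupp.mem_support_iff.mp hk') i
  rw [Finsupp.smul_apply, smul_eq_mul] at hne
  have := right_ne_zero_of_mul hne
  omega

/-- A connected multi-index below `kA + kB` is below one of the two pieces. -/
theorem le_or_le_of_not_isDisconnected {kA kB k' : Fin m →₀ ℕ}
    (hk : Disjoint kA.support kB.support)
    (hV : Disjoint (indexSupport V kA) (indexSupport V kB)) (hle : k' ≤ kA + kB)
    (hconn : ¬ IsDisconnected V k') : k' ≤ kA ∨ k' ≤ kB := by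
  have hsplit : k' ⊓ kA + k' ⊓ kB = k' := by
    ext i
    have h1 := hle i
    simp only [Finsupp.add_apply, Finsupp.inf_apply] at h1 ⊢
    by_cases hi : i ∈ kA.support
    · have := Finsupp.notMem_support_iff.mp (Finset.disjoint_left.mp hk hi)
      omega
    · have := Finsupp.notMem_support_iff.mp hi
      omega
  -- Otherwise both meets are nonzero, and they exhibit `k'` as disconnected.
  by_contra! hno
  refine hconn ⟨k' ⊓ kA, k' ⊓ kB, fun h0 => hno.2 ?_, fun h0 => hno.1 ?_, hsplit.symm,
    hV.mono (indexSupport_mono V inf_le_right) (indexSupport_mono V inf_le_right)⟩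
  · rw [← hsplit, h0, zero_add]
    exact inf_le_right
  · rw [← hsplit, h0, add_zero]
    exact inf_le_right

open Classical in
/-- The nonlinear part of the expansion at a disconnected order factorizes if the parameters of
lower disconnected orders vanish. -/
theorem SolvesFixingEquations.sum_nonlinear_eq_mul (hg : IsGenerating T gen) (hm : IsMatched V T)
    (hθ : SolvesFixingEquations h V T gen θ) {kA kB : Fin m →₀ ℕ} (hA0 : kA ≠ 0) (hB0 : kB ≠ 0)
    (hk : Disjoint kA.support kB.support)
    (hV : Disjoint (indexSupport V kA) (indexSupport V kB))
    (hlow : ∀ k', k' < kA + kB → IsDisconnected V k' → ∀ i, θ i k' = 0) :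
    ∑ f ∈ (admissibleSet_finite hθ.zero_order (kA + kB)).toFinset with f (kA + kB) = 0,
      ansatzTerm V T θ (kA + kB) f = ansatzCoeff V T θ kA * ansatzCoeff V T θ kB := by
  have hAlt : ¬ kA + kB ≤ kA := fun hle => hB0 (le_antisymm (by simpa using hle) zero_le)
  have hBlt : ¬ kA + kB ≤ kB := fun hle => hA0 (le_antisymm (by simpa using hle) zero_le)
  rw [ansatzCoeff_eq_sum V T hθ.zero_order, ansatzCoeff_eq_sum V T hθ.zero_order,
    Finset.sum_mul_sum, ← Finset.sum_product']
  symm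
  refine Finset.sum_of_injOn (fun q => q.1 + q.2) ?_ ?_ ?_ ?_
  -- The first summand is recovered from the sum by keeping the orders below `kA`, which gives
  -- injectivity.
  · have hfil : ∀ q : ExpIndex m p × ExpIndex m p, q.1 ∈ admissibleSet θ kA →
        q.2 ∈ admissibleSet θ kB → (q.1 + q.2).filter (· ≤ kA) = q.1 := by
      intro q h1 h2
      rw [Finsupp.filter_add, (Finsupp.filter_eq_self_iff _ _).mpr,
        (Finsupp.filter_eq_zero_iff _ _).mpr, add_zero]
      · intro k' hk'
        by_contra hne
        exact not_le_of_disjoint_support hk (ne_zero_of_mem_admissibleSet hθ.zero_order h2 hne)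
          hk' (le_of_mem_admissibleSet h2 hne)
      · intro k' hk'
        exact le_of_mem_admissibleSet h1 hk'
    intro q hq r hr e
    simp only [Finset.coe_product, Set.Finite.coe_toFinset, Set.mem_prod] at hq hr
    have e1 : q.1 = r.1 := by
      rw [← hfil q hq.1 hq.2, ← hfil r hr.1 hr.2]
      exact congrArg _ e
    refine Prod.ext e1 ?_
    have e' : q.1 + q.2 = r.1 + r.2 := e
    rw [e1] at e'
    exact add_left_cancel e'
  · intro q hq
    simp only [Finset.coe_product, Set.Finite.coe_toFinset, Set.mem_prod] at hq
    simp only [Finset.coe_filter, Set.Finite.mem_toFinset, Set.mem_ofPred_eq]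
    refine ⟨⟨?_, ?_⟩, ?_⟩
    · rw [totalOrder_add, hq.1.1, hq.2.1]
    · rw [thetaWeight_add θ (hθ.ansatzTerm_add hg hm hk hV hq.1 hq.2).1]
      exact mul_ne_zero hq.1.2 hq.2.2
    · have h1 : q.1 (kA + kB) = 0 := by
        by_contra hne
        exact hAlt (le_of_mem_admissibleSet hq.1 hne)
      have h2 : q.2 (kA + kB) = 0 := by
        by_contra hne
        exact hBlt (le_of_mem_admissibleSet hq.2 hne)
      rw [Finsupp.add_apply, h1, h2, add_zero]
  · intro f hf hn
    exfalso
    simp only [Finset.mem_filter, Set.Finite.mem_toFinset] at hf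
    obtain ⟨hf, hfk⟩ := hf
    -- The induction hypothesis enters here: a disconnected order strictly below `kA + kB` would
    -- make the weight of `f` vanish.
    have hle : ∀ k', f k' ≠ 0 → k' ≤ kA ∨ k' ≤ kB := by
      intro k' hk'
      have hle := le_of_mem_admissibleSet hf hk'
      refine le_or_le_of_not_isDisconnected hk hV hle fun hdis => ?_
      obtain ⟨i, hi⟩ := DFunLike.ne_iff.mp hk'
      refine theta_ne_zero_of_mem_admissibleSet hf hi (hlow k' (lt_of_le_of_ne hle ?_) hdis i)
      rintro rfl
      exact hk' hfk
    have hsum := Finsupp.filter_add_filter_not f (· ≤ kA)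
    have hA : ∀ k', f.filter (· ≤ kA) k' ≠ 0 → k' ≤ kA := by
      intro k' hk'
      by_contra hno
      exact hk' (Finsupp.filter_apply_neg _ f hno)
    have hB : ∀ k', f.filter (¬ · ≤ kA) k' ≠ 0 → k' ≤ kB := by
      intro k' hk'
      by_cases hno : k' ≤ kA
      · exact absurd (Finsupp.filter_apply_neg (fun k' => ¬ k' ≤ kA) f (not_not.mpr hno)) hk'
      · rw [Finsupp.filter_apply_pos (fun k' => ¬ k' ≤ kA) f hno] at hk'
        exact (hle k' hk').resolve_left hno
    have hdis : Disjoint (f.filter (· ≤ kA)).support (f.filter (¬ · ≤ kA)).support := by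
      rw [Finset.disjoint_left]
      intro k' h1 h2
      rw [Finsupp.support_filter, Finset.mem_filter] at h1 h2
      exact h2.2 h1.2
    have hord := hf.1
    have hth := hf.2
    rw [← hsum] at hord hth
    rw [totalOrder_add] at hord
    rw [thetaWeight_add θ hdis] at hth
    -- The orders of the two parts involve disjoint sets of couplings and add up to `kA + kB`, so
    -- they are `kA` and `kB` separately.
    have := eq_and_eq_of_add_eq hk (support_totalOrder_subset hA) (support_totalOrder_subset hB)
      hord
    refine hn ⟨(f.filter (· ≤ kA), f.filter (¬ · ≤ kA)), ?_, hsum⟩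
    simp only [Finset.coe_product, Set.Finite.coe_toFinset, Set.mem_prod]
    exact ⟨⟨this.1, left_ne_zero_of_mul hth⟩, ⟨this.2, right_ne_zero_of_mul hth⟩⟩
  · intro q hq
    simp only [Finset.mem_product, Set.Finite.mem_toFinset] at hq
    exact (hθ.ansatzTerm_add hg hm hk hV hq.1 hq.2).2.symm

/-! ### The induction over disconnected orders. -/

theorem SolvesFixingEquations.eq_zero_of_isDisconnected (h_pos : ∀ j, 0 < h j)
    (hg : IsGenerating T gen) (hm : IsMatched V T) (hθ : SolvesFixingEquations h V T gen θ)
    (k : Fin m →₀ ℕ) (hk : IsDisconnected V k) (i : Fin p) : θ i k = 0 := by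
  classical
  induction hd : k.degree using Nat.strong_induction_on generalizing k i with
  | _ d ih =>
    by_cases htriv : ∃ β, k β ≠ 0 ∧ ∀ j, V β j = Pauli.I
    · obtain ⟨β, hkβ, hβ⟩ := htriv
      exact hθ.eq_zero_of_trivial h_pos hg hβ k hkβ i
    · push Not at htriv
      obtain ⟨kA, kB, hA0, hB0, rfl, hV⟩ := hk
      -- Every active `V β` now acts on some qubit, so a shared coupling would give a shared qubit.
      have hdis : Disjoint kA.support kB.support := by
        rw [Finset.disjoint_left]
        intro β h1 h2
        rw [Finsupp.mem_support_iff] at h1 h2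
        obtain ⟨j, hj⟩ := htriv β (by rw [Finsupp.add_apply]; omega)
        exact Set.disjoint_left.mp hV ⟨β, h1, hj⟩ ⟨β, h2, hj⟩
      refine hθ.eq_zero_of_nonlinear hg ?_ i
      rw [hθ.sum_nonlinear_eq_mul hg hm hA0 hB0 hdis hV fun k' hlt hk' i' =>
        ih _ (hd ▸ degree_lt_degree hlt) k' hk' i' rfl]
      -- The full equations at `kA` and `kB` are used, linear terms included; neither order needs to
      -- be connected.
      rw [← sub_eq_zero.mp (hθ.fixing kA), ← sub_eq_zero.mp (hθ.fixing kB)]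
      refine (groundCoeff_add (A := (indexSupport V kA).toFinset) h_pos hdis ?_ ?_).symm
      · intro β hβ j hj
        by_contra hne
        exact hj (Set.mem_toFinset.mpr ⟨β, Finsupp.mem_support_iff.mp hβ, hne⟩)
      · intro β hβ j hj
        by_contra hne
        rw [Finset.notMem_compl, Set.mem_toFinset] at hj
        exact Set.disjoint_left.mp hV hj ⟨β, Finsupp.mem_support_iff.mp hβ, hne⟩

end hierarchy

end

theorem mainTheorem2 {n m p : ℕ} (h : Fin n → ℝ) (h_pos : ∀ j, 0 < h j)
    (V : Fin m → PauliString n) (T : Fin p → PauliString n)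
    (gen : Bits n → Fin 2 → Option (Fin p)) (h_gen : IsGenerating T gen)
    (h_matched : IsMatched V T)
    (θ : Fin p → (Fin m →₀ ℕ) → ℝ) (h_theta : SolvesFixingEquations h V T gen θ)
    (k : Fin m →₀ ℕ) (h_disc : IsDisconnected V k) :
    ∀ a i, gen (stateLabel V k) a = some i → θ i k = 0 :=
  fun _ i _ => h_theta.eq_zero_of_isDisconnected h_pos h_gen h_matched k h_disc i
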